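/- Let $P(\mathbb Q)$ be the space of Borel probability measures on the rationals $\mathbb Q$ (with the usual topology), equipped with the weak topology. A set $A\subseteq P(\mathbb Q)$ is uniformly tight if for every $\varepsilon>0$ there is a compact set $C\subseteq\mathbb Q$ with $\mu(\mathbb Q\setminus C)<\varepsilon$ for all $\mu\in A$; it is $\sigma$-uniformly tight if it is covered by countably many uniformly tight sets. For $\mu\in P(\mathbb Q)$, let $\operatorname{supp}(\mu)$ be the closure in $\mathbb Q$ of $\{q\in\mathbb Q:\mu(\{q\})>0\}$. Consider the following properties of a nonempty compact set $K\subseteq P(\mathbb Q)$: (i) $\operatorname{supp}(\mu)$ is locally compact for every $\mu\in K$, and $\operatorname{supp}(\mu)\cap\operatorname{supp}(\nu)$ is finite for all distinct $\mu,\nu\in K$; (ii) every nonempty relatively open set $V$ in $K$ contains a compact set $L$ such that, whenever $A\subseteq K$ is $\sigma$-uniformly tight, $L\setminus A$ contains a compact set that is not uniformly tight. There exists a nonempty compact set $K\subseteq P(\mathbb Q)$ with properties (i) and (ii). Moreover, for every such $K$ and every Borel function $f:K\to[0,1]$ there is a Borel set $B\subseteq K$, not $\sigma$-uniformly tight, such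 that the restriction $f|_B$ is either constant or injective. (This is a weak form of the Sabok--Zapletal "1-1 or constant" property.) -/

import Mathlib

open MeasureTheory

/-- A set of Borel probability measures on `ℚ` is uniformly tight if for every `ε > 0` there is
one compact set of rationals carrying mass at least `1 - ε` for all measures in the set. -/
def UniformlyTight (A : Set (ProbabilityMeasure ℚ)) : Prop :=
  IsTightMeasureSet ((fun μ : ProbabilityMeasure ℚ => (μ : Measure ℚ)) '' A)

/-- A set of Borel probability measures on `ℚ` is `σ`-uniformly tight if it is covered by
countably many uniformly tight sets. -/
def SigmaUniformlyTight (A : Set (ProbabilityMeasure ℚ)) : Prop :=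
  ∃ S : ℕ → Set (ProbabilityMeasure ℚ), (∀ n, UniformlyTight (S n)) ∧ A ⊆ ⋃ n, S n

/-- The support of a probability measure on `ℚ`: the closure in `ℚ` of its set of atoms. -/
def ratSupport (μ : ProbabilityMeasure ℚ) : Set ℚ :=
  closure {q : ℚ | 0 < (μ : Measure ℚ) {q}}

/-- The compacta of the refined Preiss theorem in the space of probability measures on `ℚ`
with the weak topology. -/
structure IsRefinedPreissCompactum (K : Set (ProbabilityMeasure ℚ)) : Prop where
  isCompact : IsCompact K
  nonempty : K.Nonempty
  locallyCompact_support : ∀ μ ∈ K, LocallyCompactSpace (ratSupport μ)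
  finite_inter_support : ∀ μ ∈ K, ∀ ν ∈ K, μ ≠ ν → (ratSupport μ ∩ ratSupport ν).Finite
  /-- Every nonempty relatively open subset `K ∩ V` of `K` contains a compact set `L` such that,
  after removing any `σ`-uniformly tight subset of `K`, it still contains a compact set
  that is not uniformly tight. -/
  exists_compact_of_isOpen : ∀ V : Set (ProbabilityMeasure ℚ), IsOpen V → (K ∩ V).Nonempty →
    ∃ L : Set (ProbabilityMeasure ℚ), L ⊆ K ∩ V ∧ IsCompact L ∧
      ∀ A : Set (ProbabilityMeasure ℚ), A ⊆ K → SigmaUniformlyTight A →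
        ∃ C : Set (ProbabilityMeasure ℚ), C ⊆ L \ A ∧ IsCompact C ∧ ¬ UniformlyTight C

/-! The dichotomy is a Hurewicz-type construction. If some fibre of `f` is not a countable union of
uniformly tight sets, it serves as `B`. Otherwise `f` is continuous on a dense Gδ set `H` and, by
Baire, not constant on any nonempty relatively open part of `H`. Property (ii) then yields a tree of
open sets (`exists_disjoint_image_scheme`) in which siblings have disjoint `f`-images on `H`, while
no closed uniformly tight set meets all children of a node. On the points of `H` lying on branches
`f` is injective, and some branch evades any given countable cover by uniformly tight sets.

For existence, a sequence of instructions and fair coins generate a random subset of `ℕ`. The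
freezing rule leaves at most one infinite set reachable, so the random set is almost surely finite
(`ae_finite_limitSet`) and its law lives on a closed set of sequences with at most one infinite
member, which makes supports locally compact. Yet instructions can be continued so that the set
leaves any prescribed compact family of finite sets with probability bounded below
(`exists_escape`); hence cylinders of instructions give families that are not tight.
`exists_almost_disjoint_copies` transfers the laws to `ℚ`, in copies with finite pairwise
intersections.

Each measure uses two instruction sequences, chosen between by coin 0. This gives (ii): by Baire in
the first sequence, a σ-uniformly tight set misses a whole section over some fixed first sequence,
and varying the second one already destroys tightness. -/

/-! ### The constant-or-injective dichotomy in compact metric spaces. -/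

section ConstantOrInjective

open Set Filter Topology

/-- A Borel function into a second countable space is continuous on a dense `Gδ` set. -/
theorem Measurable.exists_continuousOn_dense_isGδ {Y M : Type*} [TopologicalSpace Y] [BaireSpace Y]
    [MeasurableSpace Y] [BorelSpace Y] [TopologicalSpace M] [SecondCountableTopology M]
    [MeasurableSpace M] [BorelSpace M] {f : Y → M} (hf : Measurable f) :
    ∃ H : Set Y, IsGδ H ∧ Dense H ∧ ContinuousOn f H := by
  obtain ⟨b, hbc, -, hb⟩ := TopologicalSpace.exists_countable_basis M
  have hu : ∀ s ∈ b, ∃ u : Set Y, IsOpen u ∧ (f ⁻¹' s) =ᶠ[residual Y] u := fun s hs =>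
    (hf (hb.isOpen hs).measurableSet).residualEq_isOpen
  choose! u huo hue using hu
  have hmem : (⋂ s ∈ b, {x | x ∈ f ⁻¹' s ↔ x ∈ u s}) ∈ residual Y := by
    rw [countable_bInter_mem hbc]
    intro s hs
    exact (hue s hs).mono fun x hx => iff_of_eq hx
  obtain ⟨H, hH, hG, hd⟩ := mem_residual.1 hmem
  refine ⟨H, hG, hd, ?_⟩
  intro x hx
  rw [ContinuousWithinAt, hb.nhds_hasBasis.tendsto_right_iff]
  rintro s ⟨hs, hxs⟩
  have key : ∀ y ∈ H, (y ∈ f ⁻¹' s ↔ y ∈ u s) := fun y hy => by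
    have := hH hy
    simp only [mem_iInter] at this
    exact this s hs
  filter_upwards [self_mem_nhdsWithin,
    mem_nhdsWithin_of_mem_nhds ((huo s hs).mem_nhds ((key x hx).1 hxs))] with y hy hyu
  exact (key y hy).2 hyu

variable {Y M : Type*} [MetricSpace Y] [CompactSpace Y]

/-- Either a compact set in the fibre closure, or a compact set avoiding countably many values:
in both cases there is a closed set `Z` of values with the stated accumulation property. -/
theorem exists_compact_values [MetricSpace M] [CompactSpace M] {small : Set Y → Prop}
    (h0 : small ∅) {f : Y → M} {H V L : Set Y} (hd : Dense H) (hfc : ContinuousOn f H)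
    (hL : L ⊆ V) (hLc : IsCompact L)
    (hLA : ∀ A : ℕ → Set Y, (∀ n, small (A n)) → ∃ C ⊆ L \ ⋃ n, A n, IsCompact C ∧ ¬ small C)
    (hnc : ∀ U : Set Y, IsOpen U → U.Nonempty → ∀ c, ∃ x ∈ U ∩ H, f x ≠ c) :
    ∃ L' ⊆ V, IsCompact L' ∧ ¬ small L' ∧ ∃ Z : Set M, IsClosed Z ∧
      ∀ z ∈ L', ∀ U : Set Y, IsOpen U → z ∈ U → ∀ J : Set M, IsClosed J → Disjoint Z J →
        ∃ y ∈ U ∩ H, f y ∉ Z ∪ J := by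
  have hY : Nonempty Y := by
    obtain ⟨C, -, -, hCs⟩ := hLA (fun _ => ∅) fun _ => h0
    by_contra hY
    rw [not_nonempty_iff] at hY
    exact hCs (eq_empty_of_isEmpty C ▸ h0)
  set Γ : Set (Y × M) := closure ((fun x => (x, f x)) '' H) with hΓ
  have hΓc : IsClosed Γ := isClosed_closure
  have hHΓ : ∀ x ∈ H, (x, f x) ∈ Γ := fun x hx => subset_closure ⟨x, hx, rfl⟩
  obtain ⟨D, hDH, hDc, hDd⟩ : ∃ D ⊆ H, D.Countable ∧ Dense D := hd.exists_countable_dense_subset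
  obtain ⟨d, hdD⟩ := hDc.exists_eq_range hDd.nonempty
  have hdH : ∀ n, d n ∈ H := fun n => hDH (hdD ▸ mem_range_self n)
  -- `Γ` records all limit values of `f` along `H`. Either a non-small compact `C` avoids every
  -- point having some `f (d n)` as a limit value, and `Z` is the set of limit values over `C`; or a
  -- single value `f (d n)` is a limit value on a non-small compact set, and `Z` is that value. In
  -- the second case non-constancy supplies points near `Z` but off it.
  by_cases hsm : ∀ n, small (L ∩ {x | (x, f (d n)) ∈ Γ})
  · obtain ⟨C, hC, hCc, hCs⟩ := hLA _ hsm
    refine ⟨C, hC.trans (sdiff_subset.trans hL), hCc, hCs, Prod.snd '' (Γ ∩ C ×ˢ univ), ?_, ?_⟩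
    · exact ((hΓc.isCompact.inter_right (hCc.isClosed.prod isClosed_univ)).image
        continuous_snd).isClosed
    · intro z hz U hU hzU J hJ hZJ
      have hP : IsClosed (Prod.fst '' (Γ ∩ univ ×ˢ J)) :=
        ((hΓc.isCompact.inter_right (isClosed_univ.prod hJ)).image continuous_fst).isClosed
      have hzP : z ∉ Prod.fst '' (Γ ∩ univ ×ˢ J) := by
        rintro ⟨⟨a, b⟩, ⟨hab, -, hb⟩, rfl⟩
        exact disjoint_left.1 hZJ ⟨(a, b), ⟨hab, hz, mem_univ _⟩, rfl⟩ hb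
      obtain ⟨y, ⟨hyU, hyP⟩, hyD⟩ := hDd.inter_open_nonempty _ (hU.inter hP.isOpen_compl)
        ⟨z, hzU, hzP⟩
      obtain ⟨n, rfl⟩ : ∃ n, d n = y := by rwa [hdD] at hyD
      refine ⟨d n, ⟨hyU, hdH n⟩, ?_⟩
      rintro (⟨⟨a, b⟩, ⟨hab, ha, -⟩, hb⟩ | hJ')
      · simp only at hb
        subst hb
        exact (hC ha).2 (mem_iUnion.2 ⟨n, (hC ha).1, hab⟩)
      · exact hyP ⟨(d n, f (d n)), ⟨hHΓ _ (hdH n), mem_univ _, hJ'⟩, rfl⟩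
  · push Not at hsm
    obtain ⟨n, hn⟩ := hsm
    refine ⟨_, inter_subset_left.trans hL,
      hLc.inter_right (hΓc.preimage (by fun_prop : Continuous fun x => (x, f (d n)))), hn,
      {f (d n)}, isClosed_singleton, ?_⟩
    rintro z ⟨-, hz⟩ U hU hzU J hJ hZJ
    have hq : f (d n) ∉ J := disjoint_singleton_left.1 hZJ
    obtain ⟨-, ⟨hyU, hyJ⟩, ⟨y, hyH, rfl⟩⟩ := mem_closure_iff.1 hz (U ×ˢ Jᶜ)
      (hU.prod hJ.isOpen_compl) ⟨hzU, hq⟩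
    have hW : ∀ᶠ x in 𝓝 y, x ∈ U ∧ (x ∈ H → f x ∉ J) := by
      refine Filter.Eventually.and (hU.mem_nhds hyU) ?_
      exact eventually_nhdsWithin_iff.1 ((hfc y hyH).eventually (hJ.isOpen_compl.mem_nhds hyJ))
    obtain ⟨W, hW, hWo, hyW⟩ := eventually_nhds_iff.1 hW
    obtain ⟨x, ⟨hxW, hxH⟩, hx⟩ := hnc W hWo ⟨y, hyW⟩ (f (d n))
    refine ⟨x, ⟨(hW x hxW).1, hxH⟩, ?_⟩
    rintro (h | h)
    · exact hx h
    · exact (hW x hxW).2 hxH h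

/-- One step of the Hurewicz-type scheme. -/
theorem exists_disjoint_image_scheme [MetricSpace M] [CompactSpace M] {small : Set Y → Prop}
    (h0 : small ∅) (hmono : ∀ A B : Set Y, A ⊆ B → small B → small A)
    {f : Y → M} {H V L O : Set Y} (hd : Dense H) (hfc : ContinuousOn f H)
    (hL : L ⊆ V) (hLc : IsCompact L)
    (hLA : ∀ A : ℕ → Set Y, (∀ n, small (A n)) → ∃ C ⊆ L \ ⋃ n, A n, IsCompact C ∧ ¬ small C)
    (hnc : ∀ U : Set Y, IsOpen U → U.Nonempty → ∀ c, ∃ x ∈ U ∩ H, f x ≠ c)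
    (hV : IsOpen V) (hO : IsOpen O) (hHO : H ⊆ O) {ε : ℝ} (hε : 0 < ε) :
    ∃ W : ℕ → Set Y, (∀ n, IsOpen (W n) ∧ (W n).Nonempty ∧ closure (W n) ⊆ V ∩ O ∧
        ∀ x ∈ W n, ∀ y ∈ W n, dist x y ≤ ε) ∧
      (∀ m n, m ≠ n → Disjoint (f '' (W m ∩ H)) (f '' (W n ∩ H))) ∧
      ∀ F : Set Y, IsClosed F → small F → ∃ n, Disjoint (W n) F := by
  obtain ⟨L', hL'V, hL'c, hL's, Z, hZ, key⟩ := exists_compact_values h0 hd hfc hL hLc hLA hnc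
  have hL'e : L'.Nonempty := nonempty_iff_ne_empty.2 fun h => hL's (h ▸ h0)
  -- A closed small set cannot contain `L'`, so it misses some `B n`; placing the `n`-th child
  -- inside `B n` gives the last clause.
  obtain ⟨B, hB1, hB2⟩ : ∃ B : ℕ → Set Y, (∀ n, IsOpen (B n) ∧ (B n ∩ L').Nonempty) ∧
      ∀ U, IsOpen U → (U ∩ L').Nonempty → ∃ n, B n ⊆ U := by
    obtain ⟨b, hbc, -, hb⟩ := TopologicalSpace.exists_countable_basis Y
    have hbc' : {s ∈ b | (s ∩ L').Nonempty}.Countable := hbc.mono (sep_subset _ _)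
    have hne : {s ∈ b | (s ∩ L').Nonempty}.Nonempty := by
      obtain ⟨z, hz⟩ := hL'e
      obtain ⟨s, hs, hzs, -⟩ := hb.exists_subset_of_mem_open (mem_univ z) isOpen_univ
      exact ⟨s, hs, z, hzs, hz⟩
    obtain ⟨B, hB⟩ := hbc'.exists_eq_range hne
    refine ⟨B, fun n => ?_, fun U hU hUL => ?_⟩
    · have : B n ∈ {s ∈ b | (s ∩ L').Nonempty} := hB ▸ mem_range_self n
      exact ⟨hb.isOpen this.1, this.2⟩
    · obtain ⟨z, hzU, hz⟩ := hUL
      obtain ⟨s, hs, hzs, hsU⟩ := hb.exists_subset_of_mem_open hzU hU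
      have : s ∈ {s ∈ b | (s ∩ L').Nonempty} := ⟨hs, z, hzs, hz⟩
      rw [hB] at this
      obtain ⟨n, rfl⟩ := this
      exact ⟨n, hsU⟩
  -- `J` accumulates closed neighbourhoods of the images used so far. Keeping it disjoint from `Z`
  -- is what allows `key` to be applied again.
  have step : ∀ (n : ℕ) (J : {J : Set M // IsClosed J ∧ Disjoint Z J}),
      ∃ (W : Set Y) (J' : {J : Set M // IsClosed J ∧ Disjoint Z J}),
        IsOpen W ∧ W.Nonempty ∧ closure W ⊆ V ∩ O ∩ B n ∧ (∀ x ∈ W, ∀ y ∈ W, dist x y ≤ ε) ∧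
        J.1 ⊆ J'.1 ∧ f '' (W ∩ H) ⊆ J'.1 ∧ Disjoint J.1 (f '' (W ∩ H)) := by
    rintro n ⟨J, hJ, hZJ⟩
    obtain ⟨hBo, z, hzB, hz⟩ := hB1 n
    obtain ⟨y, ⟨⟨hyB, hyV⟩, hyH⟩, hyZJ⟩ := key z hz (B n ∩ V) (hBo.inter hV) ⟨hzB, hL'V hz⟩ J hJ hZJ
    obtain ⟨r, hr, hrb⟩ := Metric.nhds_basis_closedBall.mem_iff.1
      ((hZ.union hJ).isOpen_compl.mem_nhds hyZJ)
    have h1 : ∀ᶠ x in 𝓝 y, x ∈ V ∩ O ∩ B n ∧ (x ∈ H → f x ∈ Metric.closedBall (f y) r) := by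
      refine Filter.Eventually.and (((hV.inter hO).inter hBo).mem_nhds ⟨⟨hyV, hHO hyH⟩, hyB⟩) ?_
      exact eventually_nhdsWithin_iff.1
        ((hfc y hyH).eventually (Metric.closedBall_mem_nhds (f y) hr))
    obtain ⟨s, hs, hsb⟩ := Metric.nhds_basis_closedBall.mem_iff.1 h1
    have hball : Metric.ball y (min s (ε / 2)) ⊆ Metric.closedBall y s :=
      (Metric.ball_subset_ball (min_le_left _ _)).trans Metric.ball_subset_closedBall
    refine ⟨Metric.ball y (min s (ε / 2)), ⟨J ∪ Metric.closedBall (f y) r,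
      hJ.union Metric.isClosed_closedBall, hZJ.union_right ?_⟩, Metric.isOpen_ball,
      ⟨y, Metric.mem_ball_self (lt_min hs (half_pos hε))⟩, ?_, ?_, subset_union_left, ?_, ?_⟩
    · exact disjoint_left.2 fun q hq hq' => hrb hq' (Or.inl hq)
    · exact fun x hx => (hsb (closure_minimal hball Metric.isClosed_closedBall hx)).1
    · intro a ha b hb
      have h1 := (Metric.mem_ball.1 ha).trans_le (min_le_right _ _)
      have h2 := (Metric.mem_ball.1 hb).trans_le (min_le_right _ _)
      have := dist_triangle_right a b y
      linarith
    · rintro _ ⟨x, ⟨hx, hxH⟩, rfl⟩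
      exact Or.inr ((hsb (hball hx)).2 hxH)
    · refine disjoint_left.2 ?_
      rintro _ hq ⟨x, ⟨hx, hxH⟩, rfl⟩
      exact hrb ((hsb (hball hx)).2 hxH) (Or.inr hq)
  choose W J' h using step
  let J : ℕ → {J : Set M // IsClosed J ∧ Disjoint Z J} := fun n =>
    Nat.rec ⟨∅, isClosed_empty, disjoint_empty _⟩ (fun n J => J' n J) n
  have hJm : Monotone fun n => (J n).1 := monotone_nat_of_le_succ fun n => (h n (J n)).2.2.2.2.1
  have hdis : ∀ m n, m < n →
      Disjoint (f '' (W m (J m) ∩ H)) (f '' (W n (J n) ∩ H)) := fun m n hmn =>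
    (h n (J n)).2.2.2.2.2.2.mono_left (((h m (J m)).2.2.2.2.2.1).trans (hJm hmn))
  refine ⟨fun n => W n (J n), fun n => ⟨(h n (J n)).1, (h n (J n)).2.1,
    (h n (J n)).2.2.1.trans inter_subset_left, (h n (J n)).2.2.2.1⟩, fun m n hmn => ?_, ?_⟩
  · rcases lt_or_gt_of_ne hmn with hlt | hlt
    · exact hdis m n hlt
    · exact (hdis n m hlt).symm
  · intro F hF hFs
    have : ¬ L' ⊆ F := fun hsub => hL's (hmono _ _ hsub hFs)
    obtain ⟨z, hz, hzF⟩ := not_subset.1 this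
    obtain ⟨n, hn⟩ := hB2 _ hF.isOpen_compl ⟨z, hzF, hz⟩
    refine ⟨n, disjoint_left.2 fun x hx hxF => hn ?_ hxF⟩
    exact ((h n (J n)).2.2.1 (subset_closure hx)).2

/-- Sets small up to countable unions. -/
def SigmaSmall (small : Set Y → Prop) (B : Set Y) : Prop :=
  ∃ S : ℕ → Set Y, (∀ n, small (S n)) ∧ B ⊆ ⋃ n, S n

/-- If every nonempty open set contains a compact set from which no countable union of small sets
removes all non-small compact sets, then every Borel map is constant or injective on a Borel set
which is not a countable union of small sets. -/
theorem exists_measurableSet_const_or_injOn [Nonempty Y] [MeasurableSpace Y] [BorelSpace Y]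
    [MetricSpace M] [CompactSpace M] [MeasurableSpace M] [BorelSpace M] {small : Set Y → Prop}
    (h0 : small ∅) (hmono : ∀ A B : Set Y, A ⊆ B → small B → small A)
    (hclosure : ∀ A : Set Y, small A → small (closure A))
    (hL : ∀ V : Set Y, IsOpen V → V.Nonempty → ∃ L ⊆ V, IsCompact L ∧
      ∀ A : ℕ → Set Y, (∀ n, small (A n)) → ∃ C ⊆ L \ ⋃ n, A n, IsCompact C ∧ ¬ small C)
    {f : Y → M} (hf : Measurable f) :
    ∃ B : Set Y, MeasurableSet B ∧ ¬ SigmaSmall small B ∧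
      ((∃ c, ∀ x ∈ B, f x = c) ∨ InjOn f B) := by
  by_cases hconst : ∃ c, ¬ SigmaSmall small (f ⁻¹' {c})
  · obtain ⟨c, hc⟩ := hconst
    exact ⟨_, hf (measurableSet_singleton c), hc, Or.inl ⟨c, fun x hx => hx⟩⟩
  push Not at hconst
  obtain ⟨H, hHG, hHd, hfc⟩ := hf.exists_continuousOn_dense_isGδ
  have hnc : ∀ U : Set Y, IsOpen U → U.Nonempty → ∀ c, ∃ x ∈ U ∩ H, f x ≠ c := by
    intro U hU hUn c
    by_contra! hcon
    obtain ⟨S, hS, hcS⟩ := hconst c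
    -- If `f` were constant on `U ∩ H`, Baire would give some `closure (S n)` an interior point in
    -- `U`; but that closure is small, whereas every nonempty open set contains a non-small compact
    -- set.
    have hcov : H ⊆ ⋃ n : Option ℕ, n.elim Uᶜ fun n => closure (S n) := by
      intro x hx
      by_cases hxU : x ∈ U
      · obtain ⟨n, hn⟩ := mem_iUnion.1 (hcS (hcon x ⟨hxU, hx⟩))
        exact mem_iUnion.2 ⟨some n, subset_closure hn⟩
      · exact mem_iUnion.2 ⟨none, hxU⟩
    have hden := hHG.dense_iUnion_interior_of_closed hHd (fun n => by
      cases n with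
      | none => exact hU.isClosed_compl
      | some n => exact isClosed_closure) hcov
    obtain ⟨x, hxU, hx⟩ := hden.inter_open_nonempty U hU hUn
    obtain ⟨n, hn⟩ := mem_iUnion.1 hx
    cases n with
    | none => exact interior_subset hn hxU
    | some n =>
      obtain ⟨L, hLV, -, hLA⟩ := hL _ isOpen_interior ⟨x, hn⟩
      obtain ⟨C, hC, -, hCs⟩ := hLA (fun _ => ∅) fun _ => h0
      exact hCs (hmono _ _ ((hC.trans sdiff_subset).trans (hLV.trans interior_subset))
        (hclosure _ (hS n)))
  obtain ⟨O, hO, rfl⟩ := hHG.eq_iInter_nat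
  have step : ∀ (V : {V : Set Y // IsOpen V ∧ V.Nonempty}) (k : ℕ),
      ∃ W : ℕ → {V : Set Y // IsOpen V ∧ V.Nonempty},
        (∀ n, closure (W n).1 ⊆ V.1 ∩ O k ∧
          ∀ x ∈ (W n).1, ∀ y ∈ (W n).1, dist x y ≤ 1 / ((k : ℝ) + 1)) ∧
        (∀ m n, m ≠ n →
          Disjoint (f '' ((W m).1 ∩ ⋂ k, O k)) (f '' ((W n).1 ∩ ⋂ k, O k))) ∧
        ∀ F : Set Y, IsClosed F → small F → ∃ n, Disjoint (W n).1 F := by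
    rintro ⟨V, hVo, hVn⟩ k
    obtain ⟨L, hLV, hLc, hLA⟩ := hL V hVo hVn
    obtain ⟨W, h1, h2, h3⟩ := exists_disjoint_image_scheme h0 hmono hHd hfc hLV hLc hLA hnc hVo
      (hO k) (iInter_subset _ k) (Nat.one_div_pos_of_nat (α := ℝ) (n := k))
    exact ⟨fun n => ⟨W n, (h1 n).1, (h1 n).2.1⟩, fun n => (h1 n).2.2, h2, h3⟩
  choose W hW1 hW2 hW3 using step
  let T : List ℕ → {V : Set Y // IsOpen V ∧ V.Nonempty} := fun s =>
    List.rec ⟨univ, isOpen_univ, univ_nonempty⟩ (fun n s V => W V s.length n) s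
  have hTsub : ∀ n s, closure (T (n :: s)).1 ⊆ (T s).1 ∩ O s.length := fun n s =>
    (hW1 (T s) s.length n).1
  have hTuniq : ∀ s t : List ℕ, s.length = t.length → ∀ x ∈ (T s).1 ∩ ⋂ k, O k,
      ∀ y ∈ (T t).1 ∩ ⋂ k, O k, f x = f y → s = t := by
    intro s
    induction s with
    | nil => intro t ht _ _ _ _ _; exact (List.length_eq_zero_iff.1 ht.symm).symm
    | cons a s ih =>
      intro t ht x hx y hy hxy
      cases t with
      | nil => simp at ht
      | cons b t =>
        have hst : s = t := ih t (by simpa using ht) x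
          ⟨(hTsub a s (subset_closure hx.1)).1, hx.2⟩ y
          ⟨(hTsub b t (subset_closure hy.1)).1, hy.2⟩ hxy
        subst hst
        by_contra hne
        have hab : a ≠ b := fun h => hne (h ▸ rfl)
        exact disjoint_left.1 (hW2 (T s) s.length a b hab) ⟨x, hx, rfl⟩ ⟨y, hy, hxy.symm⟩
  refine ⟨(⋂ k, ⋃ s : {s : List ℕ // s.length = k}, (T s.1).1) ∩ ⋂ k, O k, ?_, ?_, Or.inr ?_⟩
  · exact (MeasurableSet.iInter fun k => (isOpen_iUnion fun s : {s : List ℕ // s.length = k} => (T s.1).2.1).measurableSet).inter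
      (MeasurableSet.iInter fun k => (hO k).measurableSet)
  · rintro ⟨S, hS, hBS⟩
    -- At level `k` the branch turns into a child avoiding `closure (S k)`; compactness then
    -- provides a point on the branch outside every `S k`.
    have hnext : ∀ (s : List ℕ) (k : ℕ), ∃ n, Disjoint (T (n :: s)).1 (closure (S k)) := fun s k =>
      hW3 (T s) s.length _ isClosed_closure (hclosure _ (hS k))
    choose nx hnx using hnext
    let b : ℕ → List ℕ := fun k => Nat.rec [] (fun k s => nx s k :: s) k
    have hblen : ∀ k, (b k).length = k := by
      intro k
      induction k with
      | zero => rfl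
      | succ k ih => exact congrArg (· + 1) ih
    have hbs : ∀ k, closure (T (b (k + 1))).1 ⊆ (T (b k)).1 ∩ O k := fun k => by
      have := hTsub (nx (b k) k) (b k)
      rwa [hblen] at this
    obtain ⟨x, hx⟩ := IsCompact.nonempty_iInter_of_sequence_nonempty_isCompact_isClosed
      (fun k => closure (T (b k)).1)
      (fun k => (hbs k).trans (inter_subset_left.trans subset_closure))
      (fun k => (T (b k)).2.2.closure) isClosed_closure.isCompact fun k => isClosed_closure
    rw [mem_iInter] at hx
    have hxT : ∀ k, x ∈ (T (b k)).1 := fun k => (hbs k (hx (k + 1))).1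
    obtain ⟨k, hk⟩ := mem_iUnion.1 (hBS ⟨mem_iInter.2 fun k => mem_iUnion.2
      ⟨⟨b k, hblen k⟩, hxT k⟩, mem_iInter.2 fun k => (hbs k (hx (k + 1))).2⟩)
    exact disjoint_left.1 (hnx (b k) k) (hxT (k + 1)) (subset_closure hk)
  · rintro x ⟨hx, hxH⟩ y ⟨hy, hyH⟩ hxy
    rw [mem_iInter] at hx hy
    have hdist : ∀ k : ℕ, dist x y ≤ 1 / ((k : ℝ) + 1) := by
      intro k
      obtain ⟨⟨s, hs⟩, hxs⟩ := mem_iUnion.1 (hx (k + 1))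
      obtain ⟨⟨t, ht⟩, hyt⟩ := mem_iUnion.1 (hy (k + 1))
      obtain rfl := hTuniq s t (hs.trans ht.symm) x ⟨hxs, hxH⟩ y ⟨hyt, hyH⟩ hxy
      cases s with
      | nil => simp at hs
      | cons a s =>
        obtain rfl : s.length = k := by simpa using hs
        exact (hW1 (T s) s.length a).2 x hxs y hyt
    exact dist_le_zero.1 (ge_of_tendsto' tendsto_one_div_add_atTop_nhds_zero_nat hdist)

end ConstantOrInjective

/-! ### Closed embeddings of countable metric spaces into the rationals. -/

section RationalEmbedding

open Set Filter Topology

theorem interior_cantorSet : interior cantorSet = ∅ := by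
  have htd : IsTotallyDisconnected cantorSet := by
    rw [← totallyDisconnectedSpace_subtype_iff]
    exact cantorSetHomeomorphNatToBool.symm.totallyDisconnectedSpace
  refine eq_empty_iff_forall_notMem.2 fun x hx => ?_
  obtain ⟨r, hr, hrs⟩ := Metric.nhds_basis_closedBall.mem_iff.1 (mem_interior_iff_mem_nhds.1 hx)
  rw [Real.closedBall_eq_Icc] at hrs
  have := htd _ hrs isPreconnected_Icc (left_mem_Icc.2 (by linarith)) (right_mem_Icc.2 (by linarith))
  linarith

/-- A countable metric space embeds into the Cantor space. -/
theorem exists_isEmbedding_nat_bool (E : Type*) [MetricSpace E] [Countable E] :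
    ∃ φ : E → ℕ → Bool, IsEmbedding φ := by
  rcases isEmpty_or_nonempty E with hE | hE
  · exact ⟨fun _ _ => true, .of_subsingleton _⟩
  -- Only countably many distances occur; a radius avoiding them makes the ball clopen, and the
  -- indicators of these balls give the embedding.
  have hr : ∀ p : E × ℕ, ∃ r : ℝ, 0 < r ∧ r < 1 / ((p.2 : ℝ) + 1) ∧ ∀ t, dist t p.1 ≠ r := by
    intro p
    obtain ⟨r, hr, h⟩ := ((countable_range fun t => dist t p.1).dense_compl ℝ).exists_between
      (Nat.one_div_pos_of_nat (α := ℝ) (n := p.2))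
    exact ⟨r, h.1, h.2, fun t ht => hr ⟨t, ht⟩⟩
  choose r hr0 hr1 hr2 using hr
  have hclopen : ∀ p, IsClopen (Metric.ball p.1 (r p)) := fun p => by
    refine ⟨?_, Metric.isOpen_ball⟩
    have : Metric.ball p.1 (r p) = Metric.closedBall p.1 (r p) := by
      ext t
      rw [Metric.mem_ball, Metric.mem_closedBall]
      exact ⟨le_of_lt, fun h => lt_of_le_of_ne h (hr2 p t)⟩
    rw [this]
    exact Metric.isClosed_closedBall
  obtain ⟨e, he⟩ := exists_surjective_nat (E × ℕ)
  classical
  have hcont : Continuous fun (t : E) (k : ℕ) => decide (t ∈ Metric.ball (e k).1 (r (e k))) :=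
    continuous_pi fun k => by
      refine continuous_discrete_rng.2 fun b => ?_
      cases b with
      | true =>
        convert (hclopen (e k)).isOpen using 1
        ext t
        simp
      | false =>
        convert (hclopen (e k)).compl.isOpen using 1
        ext t
        simp
  have hind : IsInducing fun (t : E) (k : ℕ) => decide (t ∈ Metric.ball (e k).1 (r (e k))) := by
    refine isInducing_iff_nhds.2 fun t => le_antisymm hcont.continuousAt.le_comap ?_
    refine Metric.nhds_basis_ball.ge_iff.2 fun ε hε => ?_
    obtain ⟨n, hn⟩ := exists_nat_one_div_lt (half_pos hε)
    obtain ⟨k, hk⟩ := he (t, n)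
    refine mem_comap.2 ⟨(fun g => g k) ⁻¹' {true}, ?_, ?_⟩
    · exact (continuous_apply k).continuousAt.preimage_mem_nhds
        ((isOpen_discrete _).mem_nhds (by simp [hk, hr0]))
    · intro s hs
      simp only [mem_preimage, mem_singleton_iff, decide_eq_true_eq, hk, Metric.mem_ball] at hs
      rw [Metric.mem_ball]
      have := hr1 (t, n)
      simp only at this
      linarith
  exact ⟨_, hind.isEmbedding⟩

/-- A countable dense set of reals is homeomorphic to the rationals. -/
theorem exists_homeomorph_rat {D : Set ℝ} (hDc : D.Countable) (hDd : Dense D) :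
    Nonempty (D ≃ₜ ℚ) := by
  have := hDc.to_subtype
  have : Nonempty D := hDd.nonempty.to_subtype
  have : DenselyOrdered D := ⟨fun a b hab => by
    obtain ⟨c, hc, h1, h2⟩ := hDd.exists_between (show (a : ℝ) < b from hab)
    exact ⟨⟨c, hc⟩, h1, h2⟩⟩
  have : NoMinOrder D := ⟨fun a => by
    obtain ⟨c, hc, h⟩ := hDd.exists_lt (a : ℝ)
    exact ⟨⟨c, hc⟩, h⟩⟩
  have : NoMaxOrder D := ⟨fun a => by
    obtain ⟨c, hc, h⟩ := hDd.exists_gt (a : ℝ)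
    exact ⟨⟨c, hc⟩, h⟩⟩
  obtain ⟨e⟩ := Order.iso_of_countable_dense D ℚ
  refine ⟨⟨e.toEquiv, ?_, ?_⟩⟩
  · refine OrderTopology.continuous_iff.2 fun q => ⟨?_, ?_⟩
    · have : e.toFun ⁻¹' Ioi q = Subtype.val ⁻¹' Ioi ((e.symm q : D) : ℝ) := by
        ext x
        exact (e.symm_apply_lt (x := x) (y := q)).symm
      rw [this]
      exact isOpen_Ioi.preimage continuous_subtype_val
    · have : e.toFun ⁻¹' Iio q = Subtype.val ⁻¹' Iio ((e.symm q : D) : ℝ) := by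
        ext x
        exact (e.lt_symm_apply (x := x) (y := q)).symm
      rw [this]
      exact isOpen_Iio.preimage continuous_subtype_val
  -- The topology of `D` is the one induced from `ℝ`, so continuity of the inverse is checked as a
  -- map into `ℝ`: it is monotone with dense range.
  · refine continuous_induced_rng.2 (Monotone.continuous_of_denseRange
      (fun a b hab => e.symm.monotone hab) ?_)
    have : range (Subtype.val ∘ e.toEquiv.symm) = D := by
      rw [range_comp, e.toEquiv.symm.range_eq_univ, image_univ, Subtype.range_val]
    rw [DenseRange]
    exact (congrArg Dense this).mpr hDd

/-- A countable metric space is homeomorphic to a closed subspace of the rationals. -/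
theorem exists_isClosedEmbedding_rat (E : Type*) [MetricSpace E] [Countable E] :
    ∃ h : E → ℚ, IsClosedEmbedding h := by
  obtain ⟨φ, hφ⟩ := exists_isEmbedding_nat_bool E
  let ψ : E → ℝ := fun s => (cantorSetHomeomorphNatToBool.symm (φ s) : ℝ)
  have hψ : IsEmbedding ψ :=
    IsEmbedding.subtypeVal.comp (cantorSetHomeomorphNatToBool.symm.isEmbedding.comp hφ)
  have hψC : range ψ ⊆ cantorSet := range_subset_iff.2 fun s => Subtype.coe_prop _
  -- Filling up with points off the Cantor set gives a countable dense set of reals whose trace on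
  -- the Cantor set is exactly the copy of `E`, hence closed.
  obtain ⟨D₀, hD₀, hD₀c, hD₀d⟩ : ∃ D ⊆ cantorSetᶜ, D.Countable ∧ Dense D :=
    (interior_eq_empty_iff_dense_compl.1 interior_cantorSet).exists_countable_dense_subset
  obtain ⟨e⟩ := exists_homeomorph_rat ((countable_range ψ).union hD₀c)
    (hD₀d.mono subset_union_right)
  let χ : E → (range ψ ∪ D₀ : Set ℝ) := fun s => ⟨ψ s, Or.inl (mem_range_self s)⟩
  have hχ : IsClosedEmbedding χ := by
    refine ⟨hψ.codRestrict _ fun s => Or.inl (mem_range_self s), ?_⟩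
    have : range χ = Subtype.val ⁻¹' cantorSet := by
      ext ⟨x, hx⟩
      constructor
      · rintro ⟨s, hs⟩
        exact hψC ⟨s, congrArg Subtype.val hs⟩
      · intro hxC
        rcases hx with ⟨s, rfl⟩ | hx
        · exact ⟨s, rfl⟩
        · exact absurd hxC (hD₀ hx)
    rw [this]
    exact isClosed_cantorSet.preimage continuous_subtype_val
  exact ⟨e ∘ χ, e.isClosedEmbedding.comp hχ⟩

end RationalEmbedding

/-! ### Uniform tightness, and the dichotomy for measures. -/

section Tightness

open Set Filter Topology
open scoped ENNReal

theorem uniformlyTight_iff {A : Set (ProbabilityMeasure ℚ)} :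
    UniformlyTight A ↔ ∀ ε : ℝ≥0∞, 0 < ε → ∃ K : Set ℚ, IsCompact K ∧
      ∀ μ ∈ A, (μ : Measure ℚ) Kᶜ ≤ ε := by
  rw [UniformlyTight, isTightMeasureSet_iff_exists_isCompact_measure_compl_le]
  simp

theorem UniformlyTight.mono {A B : Set (ProbabilityMeasure ℚ)} (hB : UniformlyTight B)
    (h : A ⊆ B) : UniformlyTight A :=
  IsTightMeasureSet.subset hB (image_mono h)

theorem uniformlyTight_empty : UniformlyTight ∅ :=
  uniformlyTight_iff.2 fun _ _ => ⟨∅, isCompact_empty, by simp⟩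

/-- By the portmanteau theorem the mass of the open set `Kᶜ` is lower semicontinuous, so the same
compact sets work. -/
theorem UniformlyTight.closure {A : Set (ProbabilityMeasure ℚ)} (hA : UniformlyTight A) :
    UniformlyTight (closure A) := by
  rw [uniformlyTight_iff] at hA ⊢
  intro ε hε
  obtain ⟨K, hK, h⟩ := hA ε hε
  refine ⟨K, hK, fun μ hμ => ?_⟩
  obtain ⟨u, hu, hlim⟩ := mem_closure_iff_seq_limit.1 hμ
  refine (ProbabilityMeasure.le_liminf_measure_open_of_tendsto hlim
    hK.isClosed.isOpen_compl).trans ?_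
  exact liminf_le_of_le (by isBoundedDefault) fun b hb => by
    obtain ⟨n, hn⟩ := hb.exists
    exact hn.trans (h _ (hu n))

/-- The dichotomy for compacta in the space of measures. -/
theorem IsRefinedPreissCompactum.exists_const_or_injOn {K : Set (ProbabilityMeasure ℚ)}
    (hK : IsRefinedPreissCompactum K) (f : K → Icc (0 : ℝ) 1)
    (hf : @Measurable K (Icc (0 : ℝ) 1) (borel K) (borel _) f) :
    ∃ B : Set K, MeasurableSet[borel K] B ∧ ¬ SigmaUniformlyTight (Subtype.val '' B) ∧
      ((∃ c, ∀ x ∈ B, f x = c) ∨ InjOn f B) := by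
  have : CompactSpace K := isCompact_iff_compactSpace.1 hK.isCompact
  have : Nonempty K := hK.nonempty.to_subtype
  let _ : MetricSpace K := TopologicalSpace.metrizableSpaceMetric K
  let _ : MeasurableSpace K := borel K
  have : BorelSpace K := ⟨rfl⟩
  let _ : MeasurableSpace (Icc (0 : ℝ) 1) := borel _
  have : BorelSpace (Icc (0 : ℝ) 1) := ⟨rfl⟩
  have hcond : ∀ V : Set K, IsOpen V → V.Nonempty → ∃ L ⊆ V, IsCompact L ∧
      ∀ A : ℕ → Set K, (∀ n, UniformlyTight (Subtype.val '' A n)) →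
        ∃ C ⊆ L \ ⋃ n, A n, IsCompact C ∧ ¬ UniformlyTight (Subtype.val '' C) := by
    rintro V hV ⟨x, hx⟩
    obtain ⟨V, hVo, rfl⟩ := isOpen_induced_iff.1 hV
    obtain ⟨L, hLV, hLc, hLA⟩ := hK.exists_compact_of_isOpen V hVo ⟨x, x.2, hx⟩
    have hcomp : ∀ C ⊆ K, IsCompact C → IsCompact (Subtype.val ⁻¹' C : Set K) := fun C hCK hC => by
      rw [Subtype.isCompact_iff, image_preimage_eq_of_subset (by simpa using hCK)]
      exact hC
    refine ⟨Subtype.val ⁻¹' L, preimage_mono fun x hx => (hLV hx).2,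
      hcomp L (fun x hx => (hLV hx).1) hLc, fun A hA => ?_⟩
    obtain ⟨C, hC, hCc, hCs⟩ := hLA (⋃ n, Subtype.val '' A n)
      (iUnion_subset fun n => Subtype.coe_image_subset _ _) ⟨_, hA, Subset.rfl⟩
    have hCK : C ⊆ K := fun x hx => (hLV (hC hx).1).1
    refine ⟨Subtype.val ⁻¹' C, fun x hx => ⟨(hC hx).1, fun hxA => (hC hx).2 ?_⟩,
      hcomp C hCK hCc, ?_⟩
    · obtain ⟨n, hn⟩ := mem_iUnion.1 hxA
      exact mem_iUnion.2 ⟨n, x, hn, rfl⟩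
    · rwa [image_preimage_eq_of_subset (by simpa using hCK)]
  obtain ⟨B, hB, hBs, h⟩ := exists_measurableSet_const_or_injOn
    (small := fun B : Set K => UniformlyTight (Subtype.val '' B)) (f := f)
    (by simpa using uniformlyTight_empty) (fun A B hAB hB => hB.mono (image_mono hAB))
    (fun A hA => hA.closure.mono (image_closure_subset_closure_image continuous_subtype_val))
    hcond hf
  refine ⟨B, hB, ?_, h⟩
  rintro ⟨S, hS, hBS⟩
  refine hBs ⟨fun n => Subtype.val ⁻¹' S n, fun n => (hS n).mono (image_preimage_subset _ _), ?_⟩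
  rw [← preimage_iUnion]
  exact image_subset_iff.1 hBS

end Tightness

/-! ### Independent fair coins. -/

section FairCoins

open Set Filter Topology
open scoped ENNReal

/-- The law of a fair coin. -/
noncomputable def fairCoin : Measure Bool := (PMF.uniformOfFintype Bool).toMeasure

/-- The law of a sequence of independent fair coins. -/
noncomputable def fairCoins : Measure (ℕ → Bool) := Measure.infinitePi fun _ => fairCoin

instance : IsProbabilityMeasure fairCoin := by unfold fairCoin; infer_instance

instance : IsProbabilityMeasure fairCoins := by unfold fairCoins; infer_instance

theorem fairCoin_singleton (b : Bool) : fairCoin {b} = 2⁻¹ := by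
  rw [fairCoin, PMF.toMeasure_apply_singleton _ _ (measurableSet_singleton b)]
  simp

theorem map_not_fairCoin : fairCoin.map not = fairCoin := by
  refine Measure.ext_of_singleton fun b => ?_
  rw [Measure.map_apply (measurable_of_countable _) (measurableSet_singleton b)]
  have : not ⁻¹' {b} = {!b} := by ext c; cases b <;> cases c <;> simp
  rw [this, fairCoin_singleton, fairCoin_singleton]

theorem map_flip_fairCoins (t : ℕ) :
    fairCoins.map (fun ω i => (if i = t then not else id) (ω i)) = fairCoins := by
  rw [fairCoins, Measure.infinitePi_map_pi _ fun i => measurable_of_countable _]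
  congr 1
  funext i
  split_ifs
  · exact map_not_fairCoin
  · exact Measure.map_id

/-- An event not depending on the `t`-th coin is independent of it. -/
theorem fairCoins_inter_eq (t : ℕ) (b : Bool) {B : Set (ℕ → Bool)} (hB : MeasurableSet B)
    (h : ∀ ω ω' : ℕ → Bool, (∀ i, i ≠ t → ω i = ω' i) → ω ∈ B → ω' ∈ B) :
    fairCoins (B ∩ {ω | ω t = b}) = fairCoins B * 2⁻¹ := by
  have hm : ∀ c, MeasurableSet {ω : ℕ → Bool | ω t = c} := fun c =>
    (measurable_pi_apply (X := fun _ : ℕ => Bool) t) (measurableSet_singleton c)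
  -- Flipping coin `t` preserves the measure and `B`, and exchanges the two halves.
  have hflip : ∀ c, fairCoins (B ∩ {ω | ω t = c}) = fairCoins (B ∩ {ω | ω t = !c}) := fun c => by
    conv_lhs => rw [← map_flip_fairCoins t]
    have hmeas : Measurable fun (ω : ℕ → Bool) i => (if i = t then not else id) (ω i) :=
      measurable_pi_lambda _ fun i => (measurable_of_countable _).comp (measurable_pi_apply i)
    rw [Measure.map_apply hmeas (hB.inter (hm c))]
    congr 1
    ext ω
    have h1 : ∀ i, i ≠ t → ω i = (if i = t then not else id) (ω i) := fun i hi => by simp [hi]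
    simp only [preimage_inter, mem_inter_iff, mem_preimage, mem_ofPred_eq, if_true]
    refine and_congr ⟨h _ _ fun i hi => (h1 i hi).symm, h _ _ h1⟩ ?_
    cases ω t <;> cases c <;> simp
  have hsum : fairCoins B = fairCoins (B ∩ {ω | ω t = b}) + fairCoins (B ∩ {ω | ω t = !b}) := by
    rw [← measure_union _ (hB.inter (hm _)), ← inter_union_distrib_left]
    · congr 1
      ext ω
      cases h : ω t <;> cases b <;> simp [h]
    · refine disjoint_left.2 fun ω h1 h2 => ?_
      have h3 := h1.2
      have h4 := h2.2
      simp only [mem_ofPred_eq] at h3 h4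
      rw [h3] at h4
      cases b <;> simp at h4
  rw [hsum, ← hflip b, ← two_mul, mul_comm, ← mul_assoc, ENNReal.inv_mul_cancel (by simp) (by simp),
    one_mul]

theorem fairCoins_forall_mem_eq_zero {S : Set ℕ} (hS : S.Infinite) :
    fairCoins {ω | ∀ k ∈ S, ω (k + 1) = true} = 0 := by
  refine le_antisymm ?_ zero_le
  refine ge_of_tendsto' (ENNReal.tendsto_pow_atTop_nhds_zero_of_lt_one
    (r := 2⁻¹) (by simp)) fun n => ?_
  obtain ⟨s, hsS, hs⟩ := hS.exists_subset_card_eq n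
  have hsub : {ω : ℕ → Bool | ∀ k ∈ S, ω (k + 1) = true} ⊆
      ((s.map (addRightEmbedding 1) : Finset ℕ) : Set ℕ).pi fun _ => {true} := by
    intro ω hω i hi
    obtain ⟨k, hk, rfl⟩ := Finset.mem_map.1 hi
    exact hω k (hsS hk)
  refine (measure_mono hsub).trans ?_
  rw [fairCoins, Measure.infinitePi_pi _ fun i _ => measurableSet_singleton _]
  simp [fairCoin_singleton, hs]

end FairCoins

/-! ### Random sets generated by instructions. -/

section RandomSets

open Set Filter Topology
open scoped ENNReal

/-- Instructions: at time `k`, sets with exactly `x k` elements may acquire the element `k`, and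
those with more than `x k` elements become frozen. -/
abbrev Instructions : Type := (k : ℕ) → Fin (k + 2)

/-- The set `F` has not been frozen before time `k`. -/
def IsActive (x : Instructions) (F : Finset ℕ) (k : ℕ) : Prop :=
  ∀ l < k, (F.filter (· < l)).card ≤ x l

open Classical in
/-- The random finite set at time `k`; the coin with index `k + 1` is tossed at time `k`. -/
noncomputable def randomSet (x : Instructions) (ω : ℕ → Bool) : ℕ → Finset ℕ
  | 0 => ∅
  | k + 1 =>
    if ω (k + 1) = true ∧ (randomSet x ω k).card = x k ∧ IsActive x (randomSet x ω k) k then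
      insert k (randomSet x ω k) else randomSet x ω k

/-- The characteristic function of the random set at infinity. -/
noncomputable def limitSet (x : Instructions) (ω : ℕ → Bool) (k : ℕ) : Bool :=
  decide (k ∈ randomSet x ω (k + 1))

theorem randomSet_subset_range (x : Instructions) (ω : ℕ → Bool) (n : ℕ) :
    randomSet x ω n ⊆ Finset.range n := by
  induction n with
  | zero => simp [randomSet]
  | succ n ih =>
    have h : randomSet x ω n ⊆ Finset.range (n + 1) := ih.trans (Finset.range_mono n.le_succ)
    rw [randomSet]
    split_ifs
    · exact Finset.insert_subset (Finset.self_mem_range_succ n) h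
    · exact h

theorem randomSet_subset_succ (x : Instructions) (ω : ℕ → Bool) (n : ℕ) :
    randomSet x ω n ⊆ randomSet x ω (n + 1) := by
  rw [randomSet]
  split_ifs
  · exact Finset.subset_insert _ _
  · exact Finset.Subset.refl _

theorem randomSet_mono (x : Instructions) (ω : ℕ → Bool) : Monotone (randomSet x ω) :=
  monotone_nat_of_le_succ (randomSet_subset_succ x ω)

/-- Only `k` itself can enter at time `k`, so each stage remembers all earlier ones. -/
theorem filter_randomSet (x : Instructions) (ω : ℕ → Bool) {l n : ℕ} (h : l ≤ n) :
    (randomSet x ω n).filter (· < l) = randomSet x ω l := by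
  induction n, h using Nat.le_induction with
  | base =>
    refine Finset.filter_true_of_mem fun i hi => ?_
    exact Finset.mem_range.1 (randomSet_subset_range x ω l hi)
  | succ n h ih =>
    rw [randomSet]
    split_ifs
    · rw [Finset.filter_insert, if_neg (by omega), ih]
    · exact ih

theorem randomSet_congr {x x' : Instructions} {ω ω' : ℕ → Bool} {n : ℕ}
    (hx : ∀ l < n, x l = x' l) (hω : ∀ l < n, ω (l + 1) = ω' (l + 1)) :
    randomSet x ω n = randomSet x' ω' n := by
  induction n with
  | zero => rfl
  | succ n ih =>
    have := ih (fun l hl => hx l (by omega)) fun l hl => hω l (by omega)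
    have hA : IsActive x (randomSet x' ω' n) n ↔ IsActive x' (randomSet x' ω' n) n :=
      forall₂_congr fun l hl => by rw [hx l (by omega)]
    rw [randomSet, randomSet, this, hx n n.lt_succ_self, hω n n.lt_succ_self, hA]

theorem mem_randomSet_iff {x : Instructions} {ω : ℕ → Bool} {k n : ℕ} (h : k < n) :
    k ∈ randomSet x ω n ↔ limitSet x ω k = true := by
  rw [limitSet, decide_eq_true_eq, ← filter_randomSet x ω (show k + 1 ≤ n from h)]
  simp

theorem limitSet_eq_decide {x : Instructions} {ω : ℕ → Bool} {k n : ℕ} (h : k < n) :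
    limitSet x ω k = decide (k ∈ randomSet x ω n) := by
  rw [Bool.eq_iff_iff, decide_eq_true_eq, mem_randomSet_iff h]

theorem isLocallyConstant_randomSet (n : ℕ) :
    IsLocallyConstant fun p : Instructions × (ℕ → Bool) => randomSet p.1 p.2 n := by
  refine (IsLocallyConstant.iff_eventually_eq _).2 fun p => ?_
  have h1 : ∀ᶠ q : Instructions × (ℕ → Bool) in 𝓝 p, ∀ l < n, q.1 l = p.1 l := by
    refine (Set.finite_Iio n).eventually_all.2 fun l _ => ?_
    have : Continuous fun q : Instructions × (ℕ → Bool) => q.1 l := by fun_prop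
    exact this.continuousAt.eventually ((isOpen_discrete {p.1 l}).mem_nhds rfl)
  have h2 : ∀ᶠ q : Instructions × (ℕ → Bool) in 𝓝 p, ∀ l < n, q.2 (l + 1) = p.2 (l + 1) := by
    refine (Set.finite_Iio n).eventually_all.2 fun l _ => ?_
    have : Continuous fun q : Instructions × (ℕ → Bool) => q.2 (l + 1) := by fun_prop
    exact this.continuousAt.eventually ((isOpen_discrete {p.2 (l + 1)}).mem_nhds rfl)
  filter_upwards [h1, h2] with q hq1 hq2 using randomSet_congr hq1 hq2

theorem continuous_limitSet :
    Continuous fun p : Instructions × (ℕ → Bool) => limitSet p.1 p.2 :=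
  continuous_pi fun k =>
    ((isLocallyConstant_randomSet (k + 1)).comp fun F => decide (k ∈ F)).continuous

theorem measurableSet_randomSet (x : Instructions) (n : ℕ) (P : Finset ℕ → Prop) :
    MeasurableSet {ω | P (randomSet x ω n)} := by
  have : IsOpen {ω : ℕ → Bool | P (randomSet x ω n)} :=
    (isLocallyConstant_randomSet n {F | P F}).preimage
      (by fun_prop : Continuous fun ω : ℕ → Bool => (x, ω))
  exact this.measurableSet

/-- Number of elements below `l`. -/
def countBelow (f : ℕ → Bool) (l : ℕ) : ℕ := ∑ i ∈ Finset.range l, (f i).toNat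

theorem countBelow_limitSet (x : Instructions) (ω : ℕ → Bool) (l : ℕ) :
    countBelow (limitSet x ω) l = (randomSet x ω l).card := by
  have : randomSet x ω l = (Finset.range l).filter fun i => limitSet x ω i = true := by
    ext i
    rw [Finset.mem_filter, Finset.mem_range]
    constructor
    · intro hi
      have := Finset.mem_range.1 (randomSet_subset_range x ω l hi)
      exact ⟨this, (mem_randomSet_iff this).1 hi⟩
    · rintro ⟨h1, h2⟩
      exact (mem_randomSet_iff h1).2 h2
  rw [this, Finset.card_filter, countBelow]
  refine Finset.sum_congr rfl fun i _ => ?_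
  cases limitSet x ω i <;> simp

theorem countBelow_mono (f : ℕ → Bool) : Monotone (countBelow f) := fun _ _ h =>
  Finset.sum_le_sum_of_subset (Finset.range_mono h)

theorem countBelow_succ (f : ℕ → Bool) (l : ℕ) :
    countBelow f (l + 1) = countBelow f l + (f l).toNat := Finset.sum_range_succ _ _

/-- The sets reachable under the instructions `x`. -/
def reachableSets (x : Instructions) : Set (ℕ → Bool) :=
  {f | ∀ k, f k = true → countBelow f k = x k ∧ ∀ l < k, countBelow f l ≤ x l}

theorem limitSet_mem_reachableSets (x : Instructions) (ω : ℕ → Bool) :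
    limitSet x ω ∈ reachableSets x := by
  intro k hk
  rw [limitSet, decide_eq_true_eq, randomSet] at hk
  split_ifs at hk with h
  · refine ⟨by rw [countBelow_limitSet, h.2.1], fun l hl => ?_⟩
    rw [countBelow_limitSet, ← filter_randomSet x ω hl.le]
    exact h.2.2 l hl
  · exact absurd (Finset.mem_range.1 (randomSet_subset_range x ω k hk)) (lt_irrefl k)

theorem isClosed_reachableSets (x : Instructions) : IsClosed (reachableSets x) := by
  have hc : ∀ l, Continuous fun f : ℕ → Bool => countBelow f l := fun l =>
    continuous_finsetSum _ fun i _ =>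
      (continuous_of_discreteTopology (f := Bool.toNat)).comp (continuous_apply i)
  have : reachableSets x = ⋂ k, ({f | f k = true}ᶜ ∪
      ({f | countBelow f k = x k} ∩ ⋂ l, ⋂ _ : l < k, {f | countBelow f l ≤ x l})) := by
    ext f
    simp only [reachableSets, mem_ofPred_eq, mem_iInter, mem_union, mem_compl_iff, mem_inter_iff,
      ← imp_iff_not_or]
  rw [this]
  refine isClosed_iInter fun k => IsClosed.union ?_ (IsClosed.inter ?_ ?_)
  · exact ((isOpen_discrete {true}).preimage
      (continuous_apply (A := fun _ : ℕ => Bool) k)).isClosed_compl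
  · exact isClosed_eq (hc k) continuous_const
  · exact isClosed_iInter fun l => isClosed_iInter fun _ => isClosed_le (hc l) continuous_const

/-- Let two infinite reachable sets first differ at `k`, with `k` in `f` only, and let `m` be the
next element of `g`. Then `x m` is the size of the common part below `k`, while `f` already has more
elements below `m`. So `f` is frozen at `m` and cannot be infinite. -/
theorem reachableSets_subsingleton_infinite (x : Instructions) :
    {f ∈ reachableSets x | {k | f k = true}.Infinite}.Subsingleton := by
  have key : ∀ f ∈ reachableSets x, ∀ g ∈ reachableSets x, {k | f k = true}.Infinite →
      {k | g k = true}.Infinite → ∀ k, (∀ l < k, f l = g l) → f k = true → g k = true := by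
    intro f hf g hg hfi hgi k hfg hfk
    by_contra hgk
    rw [Bool.not_eq_true] at hgk
    classical
    have hex : ∃ m, k < m ∧ g m = true := by
      obtain ⟨m, hm, hkm⟩ := hgi.exists_gt k
      exact ⟨m, hkm, hm⟩
    obtain ⟨hkm, hgm⟩ := Nat.find_spec hex
    set m := Nat.find hex
    have hmin : ∀ i, k ≤ i → i < m → g i = false := fun i hki him => by
      rcases hki.eq_or_lt with rfl | hki
      · exact hgk
      · have := Nat.find_min hex him
        simpa [hki] using this
    have hgc : ∀ i, k ≤ i → i ≤ m → countBelow g i = countBelow g k := by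
      intro i hki
      induction i, hki using Nat.le_induction with
      | base => intro _; rfl
      | succ i hki ih =>
        intro him
        rw [countBelow_succ, hmin i hki him, ih (by omega)]
        rfl
    have hck : countBelow f k = countBelow g k :=
      Finset.sum_congr rfl fun i hi => by rw [hfg i (Finset.mem_range.1 hi)]
    obtain ⟨r, hr, hmr⟩ := hfi.exists_gt m
    have h1 : countBelow f m ≤ x m := (hf r hr).2 m hmr
    have h2 : countBelow g m = x m := (hg m hgm).1
    have h3 : countBelow f (k + 1) ≤ countBelow f m := countBelow_mono f hkm
    rw [countBelow_succ, hfk] at h3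
    rw [hgc m hkm.le le_rfl] at h2
    simp only [Bool.toNat_true] at h3
    omega
  rintro f ⟨hf, hfi⟩ g ⟨hg, hgi⟩
  funext k
  induction k using Nat.strong_induction_on with
  | _ k ih =>
    rw [Bool.eq_iff_iff]
    exact ⟨key f hf g hg hfi hgi k ih, key g hg f hf hgi hfi k fun l hl => (ih l hl).symm⟩

theorem coin_of_limitSet {x : Instructions} {ω : ℕ → Bool} {k : ℕ} (h : limitSet x ω k = true) :
    ω (k + 1) = true := by
  rw [limitSet, decide_eq_true_eq, randomSet] at h
  split_ifs at h with h'
  · exact h'.1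
  · exact absurd (Finset.mem_range.1 (randomSet_subset_range x ω k h)) (lt_irrefl k)

/-- The random set can be infinite only by equalling the one infinite reachable set, which forces
infinitely many prescribed coins. -/
theorem ae_finite_limitSet (x : Instructions) :
    ∀ᵐ ω ∂fairCoins, {k | limitSet x ω k = true}.Finite := by
  rcases (reachableSets_subsingleton_infinite x).eq_empty_or_singleton with h | ⟨f, hf⟩
  · refine Eventually.of_forall fun ω => ?_
    by_contra hω
    exact (h ▸ (⟨limitSet_mem_reachableSets x ω, hω⟩ :
      limitSet x ω ∈ {f ∈ reachableSets x | {k | f k = true}.Infinite}) : limitSet x ω ∈ (∅ : Set _))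
  · have hfi : {k | f k = true}.Infinite := by
      have : f ∈ {f ∈ reachableSets x | {k | f k = true}.Infinite} := hf ▸ rfl
      exact this.2
    have hsub : {ω | ¬ {k | limitSet x ω k = true}.Finite} ⊆
        {ω | ∀ k ∈ {k | f k = true}, ω (k + 1) = true} := by
      intro ω hω k hk
      have h1 : limitSet x ω ∈ {f ∈ reachableSets x | {k | f k = true}.Infinite} :=
        ⟨limitSet_mem_reachableSets x ω, hω⟩
      rw [hf] at h1
      have h2 : limitSet x ω = f := h1
      exact coin_of_limitSet (by rw [h2]; exact hk)
    exact measure_mono_null hsub (fairCoins_forall_mem_eq_zero hfi)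

end RandomSets

/-! ### Escaping from compact families of finite sets. -/

section Escape

open Set Filter Topology
open scoped ENNReal

/-- Some member of `C` has initial segment `G` below `n`. -/
def HasInitialSegment (C : Set (ℕ → Bool)) (n : ℕ) (G : Finset ℕ) : Prop :=
  ∃ f ∈ C, ∀ k < n, f k = decide (k ∈ G)

theorem HasInitialSegment.of_randomSet {C : Set (ℕ → Bool)} {x : Instructions} {ω : ℕ → Bool}
    {m n : ℕ} (hmn : m ≤ n) (h : HasInitialSegment C n (randomSet x ω n)) :
    HasInitialSegment C m (randomSet x ω m) := by
  obtain ⟨f, hf, hfk⟩ := h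
  refine ⟨f, hf, fun k hk => ?_⟩
  rw [hfk k (hk.trans_le hmn), ← limitSet_eq_decide (hk.trans_le hmn), limitSet_eq_decide hk]

/-- Starting from the set `F` at any time, instructions can be given under which, with conditional
probability close to one, the random set leaves `C`. -/
def CanEscape (C : Set (ℕ → Bool)) (F : Finset ℕ) : Prop :=
  ∀ T, F ⊆ Finset.range T → ∀ x : Instructions, IsActive x F T → ∀ δ : ℝ≥0∞, 0 < δ →
    ∃ T' ≥ T, ∃ x' : Instructions, (∀ l < T, x' l = x l) ∧
      (∀ l, T ≤ l → l < T' → F.card ≤ (x' l : ℕ)) ∧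
      fairCoins {ω | randomSet x ω T = F ∧ HasInitialSegment C T' (randomSet x' ω T')} ≤
        δ * fairCoins {ω | randomSet x ω T = F}

theorem fairCoins_randomSet_inter (x : Instructions) (n : ℕ) (P : Finset ℕ → Prop) {t : ℕ}
    (ht : t = 0 ∨ n < t) (b : Bool) :
    fairCoins ({ω | P (randomSet x ω n)} ∩ {ω | ω t = b}) =
      fairCoins {ω | P (randomSet x ω n)} * 2⁻¹ := by
  refine fairCoins_inter_eq t b (measurableSet_randomSet x n P) fun ω ω' h hω => ?_
  have : randomSet x ω n = randomSet x ω' n :=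
    randomSet_congr (fun _ _ => rfl) fun l hl => h _ (by omega)
  exact show P _ from this ▸ hω

/-- The instruction `F.card` at time `T` sends the half with a successful coin to `insert T F`,
which then follows its own escape. Those later instructions are at least `F.card + 1`, so on the
other half `F` neither grows nor freezes and is ready for another round. -/
theorem exists_escape_round {C : Set (ℕ → Bool)} {F : Finset ℕ} {T : ℕ} (hFT : F ⊆ Finset.range T)
    (hins : CanEscape C (insert T F)) {x : Instructions} (hx : IsActive x F T)
    {δ : ℝ≥0∞} (hδ : 0 < δ) :
    ∃ T₁ ≥ T, ∃ x' : Instructions, (∀ l < T, x' l = x l) ∧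
      (∀ l, T ≤ l → l < T₁ → F.card ≤ (x' l : ℕ)) ∧ IsActive x' F T₁ ∧
      {ω | randomSet x ω T = F} ∩ {ω | ω (T + 1) = false} = {ω | randomSet x' ω T₁ = F} ∧
      fairCoins {ω | (randomSet x ω T = F ∧ ω (T + 1) = true) ∧
          HasInitialSegment C T₁ (randomSet x' ω T₁)} ≤
        δ * (fairCoins {ω | randomSet x ω T = F} * 2⁻¹) := by
  have hTF : T ∉ F := fun h => lt_irrefl T (Finset.mem_range.1 (hFT h))
  have hFcard : F.card ≤ T := by simpa using Finset.card_le_card hFT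
  have hFT' : F.filter (· < T) = F :=
    Finset.filter_true_of_mem fun i hi => Finset.mem_range.1 (hFT hi)
  let x₁ : Instructions := Function.update x T ⟨F.card, by omega⟩
  have hx₁ : ∀ l < T, x₁ l = x l := fun l hl => Function.update_of_ne hl.ne _ _
  have hx₁T : (x₁ T : ℕ) = F.card := by simp [x₁]
  have hins_sub : insert T F ⊆ Finset.range (T + 1) :=
    Finset.insert_subset (Finset.self_mem_range_succ T)
      (hFT.trans (Finset.range_mono T.le_succ))
  have hact₁ : IsActive x₁ (insert T F) (T + 1) := by
    intro l hl
    rw [Finset.filter_insert, if_neg (by omega)]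
    rcases (Nat.lt_succ_iff.1 hl).lt_or_eq with hl' | rfl
    · rw [hx₁ l hl']
      exact hx l hl'
    · rw [hFT', hx₁T]
  have hrun₁ : ∀ ω, (randomSet x ω T = F ∧ ω (T + 1) = true) ↔
      randomSet x₁ ω (T + 1) = insert T F := by
    intro ω
    have hcong : randomSet x₁ ω T = randomSet x ω T := randomSet_congr hx₁ fun _ _ => rfl
    constructor
    · rintro ⟨h1, h2⟩
      rw [randomSet, hcong, h1, if_pos]
      refine ⟨h2, hx₁T.symm, fun l hl => ?_⟩
      rw [hx₁ l hl]
      exact hx l hl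
    · intro h
      refine ⟨?_, ?_⟩
      · rw [← hcong, ← filter_randomSet x₁ ω T.le_succ, h, Finset.filter_insert,
          if_neg (lt_irrefl T), hFT']
      · exact coin_of_limitSet ((mem_randomSet_iff T.lt_succ_self).1
          (h ▸ Finset.mem_insert_self T F))
  obtain ⟨T₁, hT₁, x₂, hx₂, hx₂ge, hx₂le⟩ := hins (T + 1) hins_sub x₁ hact₁ δ hδ
  rw [Finset.card_insert_of_notMem hTF] at hx₂ge
  have hx₂T : (x₂ T : ℕ) = F.card := by rw [hx₂ T T.lt_succ_self, hx₁T]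
  have hx₂x : ∀ l < T, x₂ l = x l := fun l hl => by rw [hx₂ l (by omega), hx₁ l hl]
  have hge : ∀ l, T ≤ l → l < T₁ → F.card ≤ (x₂ l : ℕ) := fun l hl hl₁ => by
    rcases hl.eq_or_lt with rfl | hl
    · exact hx₂T.ge
    · exact (Nat.le_succ _).trans (hx₂ge l hl hl₁)
  refine ⟨T₁, by omega, x₂, hx₂x, hge, ?_, ?_, ?_⟩
  · intro l hl
    rcases lt_or_ge l T with hlT | hlT
    · rw [hx₂x l hlT]
      exact hx l hlT
    · exact (Finset.card_filter_le _ _).trans (hge l hlT hl)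
  · ext ω
    have hcong : randomSet x₂ ω T = randomSet x ω T := randomSet_congr hx₂x fun _ _ => rfl
    constructor
    · rintro ⟨h1, h2⟩
      simp only [mem_ofPred_eq] at h1 h2 ⊢
      have : ∀ n, T + 1 ≤ n → n ≤ T₁ → randomSet x₂ ω n = F := by
        intro n hn
        induction n, hn using Nat.le_induction with
        | base =>
          intro _
          rw [randomSet, if_neg (by simp [h2]), hcong, h1]
        | succ n hn ih =>
          intro hn₁
          have := hx₂ge n hn (by omega)
          rw [randomSet, ih (by omega), if_neg]
          rintro ⟨-, h, -⟩
          omega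
      exact this T₁ hT₁ le_rfl
    · intro h
      simp only [mem_ofPred_eq, mem_inter_iff] at h ⊢
      have hT : randomSet x₂ ω T = F := by
        rw [← filter_randomSet x₂ ω (show T ≤ T₁ by omega), h, hFT']
      refine ⟨hcong ▸ hT, ?_⟩
      by_contra hω
      rw [Bool.not_eq_false] at hω
      have h1 := (hrun₁ ω).1 ⟨hcong ▸ hT, hω⟩
      have h2 : randomSet x₂ ω (T + 1) = randomSet x₁ ω (T + 1) :=
        randomSet_congr hx₂ fun _ _ => rfl
      have h3 : T ∈ randomSet x₂ ω T₁ := randomSet_mono x₂ ω hT₁ (by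
        rw [h2, h1]
        exact Finset.mem_insert_self _ _)
      exact hTF (h ▸ h3)
  · have h1 : fairCoins {ω | randomSet x ω T = F} * 2⁻¹ =
        fairCoins {ω | randomSet x₁ ω (T + 1) = insert T F} := by
      rw [← fairCoins_randomSet_inter x T (· = F) (t := T + 1) (by omega) true]
      congr 1
      ext ω
      exact hrun₁ ω
    rw [h1]
    simpa only [hrun₁] using hx₂le

/-- Each round halves the probability of still being at `F`, and all but a fraction `δ` of what
leaves `F` escapes; after `N` rounds the conditional failure probability is at most `δ + 2⁻¹ ^ N`.
-/
theorem CanEscape.of_insert {C : Set (ℕ → Bool)} {F : Finset ℕ}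
    (h : ∀ n, F ⊆ Finset.range n → CanEscape C (insert n F)) : CanEscape C F := by
  have key : ∀ (δ : ℝ≥0∞), 0 < δ → ∀ N T, F ⊆ Finset.range T → ∀ x : Instructions,
      IsActive x F T → ∃ T' ≥ T, ∃ x' : Instructions, (∀ l < T, x' l = x l) ∧
      (∀ l, T ≤ l → l < T' → F.card ≤ (x' l : ℕ)) ∧
      fairCoins {ω | randomSet x ω T = F ∧ HasInitialSegment C T' (randomSet x' ω T')} ≤
        (δ + 2⁻¹ ^ N) * fairCoins {ω | randomSet x ω T = F} := by
    intro δ hδ N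
    induction N with
    | zero =>
      intro T hT x hx
      refine ⟨T, le_rfl, x, fun _ _ => rfl, fun l h1 h2 => by omega, ?_⟩
      refine (measure_mono fun ω hω => hω.1).trans ?_
      rw [pow_zero, add_mul, one_mul]
      exact le_add_self
    | succ N ih =>
      intro T hT x hx
      obtain ⟨T₁, hT₁, x₁, hx₁, hge₁, hact₁, hrun₁, hle₁⟩ := exists_escape_round hT (h T hT) hx hδ
      obtain ⟨T₂, hT₂, x₂, hx₂, hge₂, hle₂⟩ := ih T₁ (hT.trans (Finset.range_mono hT₁)) x₁ hact₁
      refine ⟨T₂, hT₁.trans hT₂, x₂, fun l hl => by rw [hx₂ l (hl.trans_le hT₁), hx₁ l hl],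
        fun l hl hl₂ => ?_, ?_⟩
      · rcases lt_or_ge l T₁ with hl₁ | hl₁
        · rw [hx₂ l hl₁]
          exact hge₁ l hl hl₁
        · exact hge₂ l hl₁ hl₂
      · rw [← hrun₁, fairCoins_randomSet_inter x T (· = F) (by omega)] at hle₂
        set p := fairCoins {ω | randomSet x ω T = F}
        have hsub : {ω | randomSet x ω T = F ∧ HasInitialSegment C T₂ (randomSet x₂ ω T₂)} ⊆
            {ω | (randomSet x ω T = F ∧ ω (T + 1) = true) ∧
              HasInitialSegment C T₁ (randomSet x₁ ω T₁)} ∪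
            {ω | randomSet x₁ ω T₁ = F ∧ HasInitialSegment C T₂ (randomSet x₂ ω T₂)} := by
          rintro ω ⟨h1, h2⟩
          cases hω : ω (T + 1) with
          | true =>
            refine Or.inl ⟨⟨h1, hω⟩, ?_⟩
            have h3 := h2.of_randomSet hT₂
            rwa [randomSet_congr hx₂ fun _ _ => rfl] at h3
          | false =>
            refine Or.inr ⟨?_, h2⟩
            have : ω ∈ {ω | randomSet x₁ ω T₁ = F} := hrun₁ ▸ ⟨h1, hω⟩
            exact this
        calc _ ≤ _ := measure_mono hsub
          _ ≤ _ := measure_union_le _ _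
          _ ≤ δ * (p * 2⁻¹) + (δ + 2⁻¹ ^ N) * (p * 2⁻¹) := add_le_add hle₁ hle₂
          _ = δ * p * (2⁻¹ + 2⁻¹) + 2⁻¹ ^ (N + 1) * p := by ring
          _ = (δ + 2⁻¹ ^ (N + 1)) * p := by rw [ENNReal.inv_two_add_inv_two]; ring
  intro T hT x hx δ hδ
  have hδ2 : 0 < δ / 2 := ENNReal.half_pos hδ.ne'
  obtain ⟨N, hN⟩ := ((ENNReal.tendsto_pow_atTop_nhds_zero_of_lt_one (r := 2⁻¹)
    (by simp)).eventually (gt_mem_nhds hδ2)).exists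
  obtain ⟨T', hT', x', h1, h2, h3⟩ := key (δ / 2) hδ2 N T hT x hx
  refine ⟨T', hT', x', h1, h2, h3.trans ?_⟩
  gcongr
  calc δ / 2 + 2⁻¹ ^ N ≤ δ / 2 + δ / 2 := by gcongr
    _ = δ := ENNReal.add_halves δ

/-- This is induction on a well-founded tree. If `∅` could not escape, `CanEscape.of_insert` would
give an increasing chain of sets that cannot escape; each is an initial segment of a member of the
closed set `C`, so their infinite union would lie in `C`. -/
theorem canEscape_empty {C : Set (ℕ → Bool)} (hC : IsClosed C)
    (hfin : ∀ f ∈ C, {k | f k = true}.Finite) : CanEscape C ∅ := by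
  by_contra h0
  have hseg : ∀ F, ¬ CanEscape C F → ∃ T, F ⊆ Finset.range T ∧ HasInitialSegment C T F := by
    intro F hF
    simp only [CanEscape] at hF
    push Not at hF
    obtain ⟨T, hT, x, -, δ, -, h⟩ := hF
    refine ⟨T, hT, ?_⟩
    -- Even waiting no time at all fails to escape, so the set `F` itself must be an initial segment
    -- from `C`.
    have h1 := h T le_rfl x (fun _ _ => rfl) fun l h1 h2 => absurd h1 (not_le.2 h2)
    obtain ⟨ω, hω⟩ := nonempty_of_measure_ne_zero ((zero_le.trans_lt h1).ne')
    exact hω.1 ▸ hω.2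
  have hstep : ∀ F : {F // ¬ CanEscape C F}, ∃ n, F.1 ⊆ Finset.range n ∧
      ¬ CanEscape C (insert n F.1) := by
    rintro ⟨F, hF⟩
    by_contra! h
    exact hF (CanEscape.of_insert h)
  choose nx hnx1 hnx2 using hstep
  let G : ℕ → {F // ¬ CanEscape C F} := fun i =>
    Nat.rec ⟨∅, h0⟩ (fun _ F => ⟨insert (nx F) F.1, hnx2 F⟩) i
  have hGs : ∀ i, (G (i + 1)).1 = insert (nx (G i)) (G i).1 := fun i => rfl
  have hmem : ∀ i, nx (G i) ∈ (G (i + 1)).1 := fun i => by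
    rw [hGs]
    exact Finset.mem_insert_self _ _
  have hmono : StrictMono fun i => nx (G i) := strictMono_nat_of_lt_succ fun i =>
    Finset.mem_range.1 (hnx1 (G (i + 1)) (hmem i))
  have hGm : Monotone fun i => (G i).1 := monotone_nat_of_le_succ fun i => by
    rw [hGs]
    exact Finset.subset_insert _ _
  classical
  let g : ℕ → Bool := fun k => decide (∃ i, k ∈ (G i).1)
  have hgG : ∀ m, ∀ k < nx (G m), g k = decide (k ∈ (G m).1) := by
    intro m k hk
    refine decide_eq_decide.2 ⟨?_, fun h => ⟨m, h⟩⟩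
    rintro ⟨i, hi⟩
    have : ∀ i, m ≤ i → k ∈ (G i).1 → k ∈ (G m).1 := by
      intro i hmi
      induction i, hmi using Nat.le_induction with
      | base => exact id
      | succ i hmi ih =>
        intro h
        rw [hGs, Finset.mem_insert] at h
        rcases h with h | h
        · have : nx (G m) ≤ nx (G i) := hmono.monotone hmi
          omega
        · exact ih h
    rcases le_total m i with h | h
    · exact this i h hi
    · exact hGm h hi
  have hgC : g ∈ C := by
    have hf : ∀ m, ∃ f ∈ C, ∀ k < m, f k = g k := by
      intro m
      obtain ⟨T, hT, f, hf, hfk⟩ := hseg (G (m + 1)).1 (G (m + 1)).2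
      refine ⟨f, hf, fun k hk => ?_⟩
      have h1 := Finset.mem_range.1 (hT (hmem m))
      have h2 : m ≤ nx (G m) := hmono.le_apply
      have h3 : nx (G m) < nx (G (m + 1)) := hmono m.lt_succ_self
      rw [hfk k (by omega), hgG (m + 1) k (by omega)]
    choose f hfC hfg using hf
    refine hC.mem_of_tendsto (b := atTop) (f := f) ?_ (Eventually.of_forall hfC)
    refine tendsto_pi_nhds.2 fun k => tendsto_nhds_of_eventually_eq ?_
    filter_upwards [eventually_gt_atTop k] with m hm using hfg m k hm
  refine (hfin g hgC).not_infinite ?_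
  refine (infinite_range_of_injective hmono.injective).mono ?_
  rintro _ ⟨i, rfl⟩
  exact decide_eq_true ⟨i + 1, hmem i⟩

theorem fairCoins_randomSet_eq_empty_pos (x : Instructions) (n : ℕ) :
    0 < fairCoins {ω | randomSet x ω n = ∅} := by
  induction n with
  | zero => simp [randomSet]
  | succ n ih =>
    have h1 : 0 < fairCoins ({ω | randomSet x ω n = ∅} ∩ {ω | ω (n + 1) = false}) := by
      rw [fairCoins_randomSet_inter x n (· = ∅) (by omega)]
      exact ENNReal.mul_pos ih.ne' (by simp)
    refine h1.trans_le (measure_mono ?_)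
    rintro ω ⟨h1, h2⟩
    simp only [mem_ofPred_eq] at h1 h2 ⊢
    rw [randomSet, if_neg (by simp [h2]), h1]

/-- In every basic open set of instructions, the random limit set escapes from all compact sets of
finite sets with probabilities bounded away from zero. -/
theorem exists_escape (b : Bool) (x : Instructions) (T : ℕ) :
    ∃ ε : ℝ≥0∞, 0 < ε ∧ ∀ C : Set (ℕ → Bool), IsClosed C → (∀ f ∈ C, {k | f k = true}.Finite) →
      ∃ x' : Instructions, (∀ l < T, x' l = x l) ∧
        ε < fairCoins {ω | ω 0 = b ∧ limitSet x' ω ∉ C} := by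
  set p := fairCoins {ω | randomSet x ω T = ∅} with hp
  have hp0 : 0 < p := fairCoins_randomSet_eq_empty_pos x T
  have hp1 : p ≠ ∞ := measure_ne_top _ _
  -- One factor is for escaping with conditional probability at least one half, one for coin 0, and
  -- the last makes the inequality strict. Nothing here depends on `C`.
  refine ⟨p * 2⁻¹ * 2⁻¹ / 2, ENNReal.half_pos (by simp [hp0.ne']), fun C hC hfin => ?_⟩
  obtain ⟨T', hT', x', hx', -, hle⟩ := canEscape_empty hC hfin T (Finset.empty_subset _) x
    (fun l _ => by simp) 2⁻¹ (by simp)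
  refine ⟨x', hx', ?_⟩
  have hrun : ∀ ω, randomSet x ω T = (randomSet x' ω T').filter (· < T) := fun ω => by
    rw [filter_randomSet x' ω hT']
    exact randomSet_congr (fun l hl => (hx' l hl).symm) fun _ _ => rfl
  let P : Finset ℕ → Prop := fun F => F.filter (· < T) = ∅ ∧ ¬ HasInitialSegment C T' F
  have h1 : p * 2⁻¹ ≤ fairCoins {ω | P (randomSet x' ω T')} := by
    have h2 : p ≤ 2⁻¹ * p + fairCoins {ω | P (randomSet x' ω T')} := by
      refine le_trans (le_trans (measure_mono ?_) (measure_union_le _ _)) (add_le_add_left hle _)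
      intro ω hω
      by_cases h : HasInitialSegment C T' (randomSet x' ω T')
      · exact Or.inl ⟨hω, h⟩
      · exact Or.inr ⟨hrun ω ▸ hω, h⟩
    have h3 : p = 2⁻¹ * p + 2⁻¹ * p := by rw [← add_mul, ENNReal.inv_two_add_inv_two, one_mul]
    rw [mul_comm]
    conv_lhs at h2 => rw [h3]
    exact (ENNReal.add_le_add_iff_left (ENNReal.mul_ne_top (by simp) hp1)).1 h2
  have h4 : p * 2⁻¹ * 2⁻¹ ≤ fairCoins {ω | ω 0 = b ∧ limitSet x' ω ∉ C} := by
    calc p * 2⁻¹ * 2⁻¹ ≤ fairCoins {ω | P (randomSet x' ω T')} * 2⁻¹ := by gcongr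
      _ = fairCoins ({ω | P (randomSet x' ω T')} ∩ {ω | ω 0 = b}) :=
        (fairCoins_randomSet_inter x' T' P (Or.inl rfl) b).symm
      _ ≤ _ := measure_mono ?_
    rintro ω ⟨hω, hb⟩
    exact ⟨hb, fun hmem => hω.2 ⟨_, hmem, fun k hk => limitSet_eq_decide hk⟩⟩
  refine lt_of_lt_of_le ?_ h4
  have h5 : p * 2⁻¹ * 2⁻¹ ≠ 0 := by simp [hp0.ne']
  have h6 : p * 2⁻¹ * 2⁻¹ ≠ ∞ := ENNReal.mul_ne_top (ENNReal.mul_ne_top hp1 (by simp)) (by simp)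
  exact ENNReal.half_lt_self h5 h6

end Escape

/-! ### Almost disjoint copies inside the rationals. -/

section Coding

open Set Filter Topology

/-- On a countable metrizable space there are continuous functions `g i`, eventually vanishing at
each point, each with finitely many zeros. -/
theorem exists_continuous_finite_zeros (E : Type*) [TopologicalSpace E]
    [TopologicalSpace.MetrizableSpace E] [Countable E] [Nonempty E] :
    ∃ g : ℕ → E → ℝ, (∀ i, Continuous (g i)) ∧ (∀ s, ∃ N, ∀ i ≥ N, g i s = 0) ∧
      ∀ i, {s | g i s = 0}.Finite := by
  let _ := TopologicalSpace.metrizableSpaceMetric E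
  obtain ⟨e, he⟩ := exists_surjective_nat E
  refine ⟨fun i s => ∏ l ∈ Finset.range (i + 1), dist s (e l), fun i => by fun_prop, fun s => ?_,
    fun i => ?_⟩
  · obtain ⟨N, rfl⟩ := he s
    exact ⟨N, fun i hi => Finset.prod_eq_zero (Finset.mem_range.2 (Nat.lt_succ_of_le hi))
      (dist_self _)⟩
  · refine ((Finset.range (i + 1)).finite_toSet.image e).subset fun s hs => ?_
    obtain ⟨l, hl, h⟩ := Finset.prod_eq_zero_iff.1 hs
    exact ⟨l, hl, (dist_eq_zero.1 h).symm⟩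

/-- Copies of a countable metrizable space `E` in `ℚ`, depending continuously on a parameter, such
that different copies have finite intersection. -/
theorem exists_almost_disjoint_copies {P E : Type*} [TopologicalSpace P] (b : ℕ → P → ℕ)
    (hb : ∀ i, Continuous (b i)) (hsep : ∀ p q, (∀ i, b i p = b i q) → p = q)
    [TopologicalSpace E] [TopologicalSpace.MetrizableSpace E] [Countable E] [Nonempty E] :
    ∃ Ψ : P × E → ℚ, Continuous Ψ ∧ (∀ p, IsClosedEmbedding fun s => Ψ (p, s)) ∧
      (∀ p q, p ≠ q → ((range fun s => Ψ (p, s)) ∩ range fun s => Ψ (q, s)).Finite) ∧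
      ∀ D : Set ℚ, IsCompact D → ∃ C : Set E, IsCompact C ∧ ∀ p s, Ψ (p, s) ∈ D → s ∈ C := by
  obtain ⟨g, hgc, hg0, hgf⟩ := exists_continuous_finite_zeros E
  -- The first coordinate recovers `s`, giving closed copies and a compact `C` independent of `p`.
  -- If `b i p ≠ b i q`, the copies can agree at `s` only where `g i s = 0`. At each `s` only
  -- finitely many `b i p` matter, so the range is countable.
  let Φ : P × E → E × (ℕ → ℝ) := fun a => (a.2, fun i => b i a.1 * g i a.2)
  have hΦ : Continuous Φ := by
    refine continuous_snd.prodMk (continuous_pi fun i => ?_)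
    exact ((continuous_of_discreteTopology (f := fun n : ℕ => (n : ℝ))).comp
      ((hb i).comp continuous_fst)).mul ((hgc i).comp continuous_snd)
  have hcount : (range Φ).Countable := by
    refine (countable_range fun a : E × List ℕ =>
      ((a.1, fun i => (a.2.getD i 0 : ℕ) * g i a.1) : E × (ℕ → ℝ))).mono ?_
    rintro _ ⟨⟨p, s⟩, rfl⟩
    obtain ⟨N, hN⟩ := hg0 s
    refine ⟨(s, (List.range N).map fun i => b i p), ?_⟩
    refine Prod.ext rfl (funext fun i => ?_)
    simp only [Φ]
    rcases lt_or_ge i N with h | h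
    · simp [List.getD, h]
    · rw [hN i h, mul_zero, mul_zero]
  have := hcount.to_subtype
  let _ := TopologicalSpace.metrizableSpaceMetric (range Φ)
  obtain ⟨h, hh⟩ := exists_isClosedEmbedding_rat (range Φ)
  have hΦ' : Continuous (rangeFactorization Φ) := hΦ.subtype_mk _
  refine ⟨h ∘ rangeFactorization Φ, hh.continuous.comp hΦ', fun p => ?_, fun p q hpq => ?_,
    fun D hD => ?_⟩
  · have hleft : Function.LeftInverse (fun z : range Φ => z.1.1)
        fun s => rangeFactorization Φ (p, s) := fun s => rfl
    exact hh.comp (hleft.isClosedEmbedding (continuous_fst.comp continuous_subtype_val)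
      (hΦ'.comp (by fun_prop)))
  · obtain ⟨i, hi⟩ : ∃ i, b i p ≠ b i q := by
      by_contra! hcon
      exact hpq (hsep p q hcon)
    refine ((hgf i).image fun s => (h ∘ rangeFactorization Φ) (p, s)).subset ?_
    rintro _ ⟨⟨s, rfl⟩, t, ht⟩
    refine ⟨s, ?_, rfl⟩
    have h1 : Φ (q, t) = Φ (p, s) := congrArg Subtype.val (hh.injective ht)
    have h2 : t = s := congrArg Prod.fst h1
    subst h2
    have h3 : (b i q : ℝ) * g i t = b i p * g i t := congrFun (congrArg Prod.snd h1) i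
    rcases mul_eq_mul_right_iff.1 h3 with h4 | h4
    · exact absurd (Nat.cast_injective h4).symm hi
    · exact h4
  · refine ⟨(fun z : range Φ => z.1.1) '' (h ⁻¹' D), (hh.isCompact_preimage hD).image
      (continuous_fst.comp continuous_subtype_val), fun p s hs => ?_⟩
    exact ⟨rangeFactorization Φ (p, s), hs, rfl⟩

end Coding

/-! ### The compactum of laws. -/

section Construction

open Set Filter Topology
open scoped ENNReal

/-- Characteristic functions of finite sets of natural numbers, as a subspace of the Cantor
space. -/
abbrev FiniteSets : Type := {f : ℕ → Bool // {k | f k = true}.Finite}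

instance : Countable FiniteSets := by
  refine Function.Injective.countable (f := fun s : FiniteSets => s.2.toFinset) fun s t h => ?_
  refine Subtype.ext (funext fun k => ?_)
  have : k ∈ s.2.toFinset ↔ k ∈ t.2.toFinset := by
    simp only at h
    rw [h]
  rw [Set.Finite.mem_toFinset, Set.Finite.mem_toFinset] at this
  exact Bool.eq_iff_iff.2 this

instance : TopologicalSpace.MetrizableSpace FiniteSets :=
  have := TopologicalSpace.metrizableSpace_of_t3_secondCountable (ℕ → Bool)
  Topology.IsEmbedding.subtypeVal.metrizableSpace

instance : Inhabited FiniteSets := ⟨⟨fun _ => false, by simp⟩⟩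

open Classical in
/-- The random finite set driven by one of two instructions, chosen by the coin with index `0`. -/
noncomputable def randomFiniteSet (p : Bool → Instructions) (ω : ℕ → Bool) : FiniteSets :=
  if h : {k | limitSet (p (ω 0)) ω k = true}.Finite then ⟨limitSet (p (ω 0)) ω, h⟩ else default

theorem ae_val_randomFiniteSet (p : Bool → Instructions) :
    ∀ᵐ ω ∂fairCoins, (randomFiniteSet p ω).1 = limitSet (p (ω 0)) ω := by
  filter_upwards [ae_finite_limitSet (p true), ae_finite_limitSet (p false)] with ω h1 h2
  have : {k | limitSet (p (ω 0)) ω k = true}.Finite := by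
    cases ω 0 <;> assumption
  rw [randomFiniteSet, dif_pos this]

theorem measurable_randomFiniteSet (p : Bool → Instructions) : Measurable (randomFiniteSet p) := by
  have hc : Measurable fun ω : ℕ → Bool => limitSet (p (ω 0)) ω := by
    have h1 : Continuous fun ω : ℕ → Bool => p (ω 0) :=
      (continuous_of_discreteTopology (f := p)).comp (continuous_apply 0)
    exact (continuous_limitSet.comp (h1.prodMk continuous_id)).measurable
  have hS : {f : ℕ → Bool | {k | f k = true}.Finite}.Countable :=
    countable_coe_iff.1 (inferInstanceAs (Countable FiniteSets))
  have hm : MeasurableSet {ω : ℕ → Bool | {k | limitSet (p (ω 0)) ω k = true}.Finite} :=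
    hc hS.measurableSet
  refine measurable_comap_iff.2 ?_
  classical
  have : Subtype.val ∘ randomFiniteSet p = fun ω =>
      if {k | limitSet (p (ω 0)) ω k = true}.Finite then limitSet (p (ω 0)) ω
      else (default : FiniteSets).1 := by
    funext ω
    rw [Function.comp_apply, randomFiniteSet]
    split_ifs <;> rfl
  rw [this]
  exact Measurable.ite hm hc measurable_const

/-- The law on the rationals of a copy of the random finite set. -/
noncomputable def rationalLaw (Ψ : (Bool → Instructions) × FiniteSets → ℚ) (hΨ : Continuous Ψ)
    (p : Bool → Instructions) : ProbabilityMeasure ℚ :=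
  ⟨fairCoins.map fun ω => Ψ (p, randomFiniteSet p ω), Measure.isProbabilityMeasure_map
    ((hΨ.comp (Continuous.prodMk_right p)).measurable.comp
      (measurable_randomFiniteSet p)).aemeasurable⟩

variable {Ψ : (Bool → Instructions) × FiniteSets → ℚ}

theorem measurable_copy (hΨ : Continuous Ψ) (p : Bool → Instructions) :
    Measurable fun ω => Ψ (p, randomFiniteSet p ω) :=
  (hΨ.comp (Continuous.prodMk_right p)).measurable.comp (measurable_randomFiniteSet p)

theorem rationalLaw_apply (hΨ : Continuous Ψ) (p : Bool → Instructions) {D : Set ℚ}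
    (hD : MeasurableSet D) :
    (rationalLaw Ψ hΨ p : Measure ℚ) D = fairCoins {ω | Ψ (p, randomFiniteSet p ω) ∈ D} :=
  Measure.map_apply (measurable_copy hΨ p) hD

/-- For almost every fixed coin sequence the random finite set varies continuously along a
convergent sequence of parameters, so dominated convergence applies. -/
theorem continuous_rationalLaw (hΨ : Continuous Ψ) : Continuous (rationalLaw Ψ hΨ) := by
  refine continuous_iff_seqContinuous.2 fun u p hu => ?_
  refine ProbabilityMeasure.tendsto_iff_forall_integral_tendsto.2 fun φ => ?_
  have hint : ∀ q, ∫ x, φ x ∂(rationalLaw Ψ hΨ q : Measure ℚ) =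
      ∫ ω, φ (Ψ (q, randomFiniteSet q ω)) ∂fairCoins := fun q =>
    integral_map (measurable_copy hΨ q).aemeasurable
      φ.continuous.measurable.aestronglyMeasurable
  simp only [Function.comp_apply, hint]
  refine tendsto_integral_of_dominated_convergence (fun _ => ‖φ‖)
    (fun n => (φ.continuous.measurable.comp (measurable_copy hΨ _)).aestronglyMeasurable)
    (integrable_const _) (fun n => Eventually.of_forall fun ω => φ.norm_coe_le_norm _) ?_
  filter_upwards [ae_all_iff.2 fun n => ae_val_randomFiniteSet (u n), ae_val_randomFiniteSet p]
    with ω h1 h2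
  refine (φ.continuous.tendsto _).comp ((hΨ.tendsto _).comp (hu.prodMk_nhds ?_))
  refine tendsto_subtype_rng.2 ?_
  simp only [h1, h2]
  have h3 : Continuous fun q : Bool → Instructions => limitSet (q (ω 0)) ω :=
    continuous_limitSet.comp
      (by fun_prop : Continuous fun q : Bool → Instructions => (q (ω 0), ω))
  exact (h3.tendsto p).comp hu

/-- In its compact closure in the Cantor space, `S` misses only infinite members of `R`, a finite
set; so it is open there. -/
theorem locallyCompactSpace_of_finite_infinite {R : Set (ℕ → Bool)} (hR : IsClosed R)
    (hfin : {f ∈ R | {k | f k = true}.Infinite}.Finite) {S : Set FiniteSets} (hS : IsClosed S)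
    (hSR : ∀ s ∈ S, s.1 ∈ R) : LocallyCompactSpace S := by
  set S' : Set (ℕ → Bool) := closure (Subtype.val '' S)
  have hS'R : S' ⊆ R := closure_minimal (by rintro _ ⟨s, hs, rfl⟩; exact hSR s hs) hR
  have : CompactSpace S' := isCompact_iff_compactSpace.1 isClosed_closure.isCompact
  let ι : S → S' := fun s => ⟨s.1.1, subset_closure ⟨s.1, s.2, rfl⟩⟩
  have hι : IsEmbedding ι :=
    (IsEmbedding.subtypeVal.comp IsEmbedding.subtypeVal).codRestrict S' _
  have hrange : range ι = (Subtype.val ⁻¹' {f ∈ R | {k | f k = true}.Infinite})ᶜ := by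
    ext ⟨f, hf⟩
    constructor
    · rintro ⟨s, hs⟩ h
      have : s.1.1 = f := congrArg Subtype.val hs
      subst this
      exact h.2 s.1.2
    · intro h
      have hff : {k | f k = true}.Finite := by
        by_contra hcon
        exact h ⟨hS'R hf, hcon⟩
      have : (⟨f, hff⟩ : FiniteSets) ∈ S := by
        rw [← hS.closure_eq, closure_subtype]
        exact hf
      exact ⟨⟨_, this⟩, rfl⟩
  have : IsOpenEmbedding ι :=
    ⟨hι, hrange ▸ (hfin.isClosed.preimage continuous_subtype_val).isOpen_compl⟩
  exact this.locallyCompactSpace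

theorem ratSupport_rationalLaw_subset (hΨ : Continuous Ψ)
    (hemb : ∀ p, IsClosedEmbedding fun s => Ψ (p, s)) (p : Bool → Instructions) :
    ratSupport (rationalLaw Ψ hΨ p) ⊆ (fun s => Ψ (p, s)) ''
      {s | s.1 ∈ reachableSets (p false) ∪ reachableSets (p true)} := by
  have hcl : IsClosed {s : FiniteSets | s.1 ∈ reachableSets (p false) ∪ reachableSets (p true)} :=
    ((isClosed_reachableSets _).union (isClosed_reachableSets _)).preimage continuous_subtype_val
  refine closure_minimal (fun q hq => ?_) ((hemb p).isClosedMap _ hcl)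
  simp only [mem_ofPred_eq] at hq
  rw [rationalLaw_apply hΨ p (measurableSet_singleton q)] at hq
  obtain ⟨ω, hω, hωv⟩ := ((frequently_ae_mem_iff.2 hq.ne').and_eventually
    (ae_val_randomFiniteSet p)).exists
  refine ⟨randomFiniteSet p ω, ?_, hω⟩
  rw [mem_ofPred_eq, hωv]
  have := limitSet_mem_reachableSets (p (ω 0)) ω
  cases h : ω 0 with
  | false => rw [h] at this; exact Or.inl this
  | true => rw [h] at this; exact Or.inr this

theorem locallyCompactSpace_ratSupport_rationalLaw (hΨ : Continuous Ψ)
    (hemb : ∀ p, IsClosedEmbedding fun s => Ψ (p, s)) (p : Bool → Instructions) :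
    LocallyCompactSpace (ratSupport (rationalLaw Ψ hΨ p)) := by
  have hsub := ratSupport_rationalLaw_subset hΨ hemb p
  set S : Set FiniteSets := (fun s => Ψ (p, s)) ⁻¹' ratSupport (rationalLaw Ψ hΨ p) with hSdef
  have hS : IsClosed S := isClosed_closure.preimage (hemb p).continuous
  have hfin : {f ∈ reachableSets (p false) ∪ reachableSets (p true) |
      {k | f k = true}.Infinite}.Finite := by
    refine ((reachableSets_subsingleton_infinite (p false)).finite.union
      (reachableSets_subsingleton_infinite (p true)).finite).subset ?_
    rintro f ⟨hf | hf, hi⟩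
    · exact Or.inl ⟨hf, hi⟩
    · exact Or.inr ⟨hf, hi⟩
  have : LocallyCompactSpace S := locallyCompactSpace_of_finite_infinite
    ((isClosed_reachableSets _).union (isClosed_reachableSets _)) hfin hS fun s hs => by
      obtain ⟨t, ht, hts⟩ := hsub hs
      exact (hemb p).injective hts ▸ ht
  have himg : (fun s => Ψ (p, s)) '' S = ratSupport (rationalLaw Ψ hΨ p) :=
    image_preimage_eq_of_subset (hsub.trans (image_subset_range _ _))
  rw [← himg]
  exact ((hemb p).isEmbedding.homeomorphImage S).symm.isClosedEmbedding.locallyCompactSpace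

/-- The instructions agreeing with `x` before time `T`. -/
def cylinderOf (x : Instructions) (T : ℕ) : Set Instructions := {x' | ∀ l < T, x' l = x l}

theorem isClopen_cylinderOf (x : Instructions) (T : ℕ) : IsClopen (cylinderOf x T) := by
  have : cylinderOf x T = ⋂ l ∈ Finset.range T, (fun x' : Instructions => x' l) ⁻¹' {x l} := by
    ext x'
    simp [cylinderOf]
  rw [this]
  exact isClopen_biInter_finset fun l _ => (isClopen_discrete _).preimage (continuous_apply l)

theorem exists_cylinderOf_subset {p : Bool → Instructions} {U : Set (Bool → Instructions)}
    (hU : U ∈ 𝓝 p) : ∃ T, ∀ q : Bool → Instructions, (∀ b, q b ∈ cylinderOf (p b) T) → q ∈ U := by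
  by_contra! h
  choose q hq hqU using h
  have : Tendsto q atTop (𝓝 p) := by
    refine tendsto_pi_nhds.2 fun b => tendsto_pi_nhds.2 fun l =>
      tendsto_nhds_of_eventually_eq ?_
    filter_upwards [eventually_gt_atTop l] with T hT using hq T b l hT
  obtain ⟨T, hT⟩ := (this.eventually hU).exists
  exact hqU T hT

/-- A compact set of rationals pulls back to one compact family of finite sets for all parameters,
and `exists_escape` defeats that family with a bound fixed in advance. -/
theorem not_uniformlyTight_image_rationalLaw (hΨ : Continuous Ψ)
    (hcpt : ∀ D : Set ℚ, IsCompact D → ∃ C : Set FiniteSets, IsCompact C ∧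
      ∀ p s, Ψ (p, s) ∈ D → s ∈ C)
    (b : Bool) (x : Instructions) (T : ℕ) {Q : Set (Bool → Instructions)}
    (hQ : ∀ x' ∈ cylinderOf x T, ∃ p ∈ Q, p b = x') :
    ¬ UniformlyTight (rationalLaw Ψ hΨ '' Q) := by
  intro htight
  obtain ⟨ε, hε, hesc⟩ := exists_escape b x T
  obtain ⟨D, hD, hDle⟩ := uniformlyTight_iff.1 htight ε hε
  obtain ⟨C, hC, hCD⟩ := hcpt D hD
  obtain ⟨x', hx', hlt⟩ := hesc (Subtype.val '' C) (hC.image continuous_subtype_val).isClosed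
    (by rintro _ ⟨s, -, rfl⟩; exact s.2)
  obtain ⟨p, hp, rfl⟩ := hQ x' hx'
  have h1 := hDle _ ⟨p, hp, rfl⟩
  rw [rationalLaw_apply hΨ p hD.isClosed.measurableSet.compl] at h1
  refine absurd (hlt.trans_le ((measure_mono_ae ?_).trans h1)) (lt_irrefl ε)
  filter_upwards [ae_val_randomFiniteSet p] with ω hω
  rintro ⟨hb, hnot⟩ hmem
  refine hnot ⟨_, hCD _ _ hmem, ?_⟩
  rw [hω, hb]

theorem exists_isRefinedPreissCompactum : ∃ K, IsRefinedPreissCompactum K := by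
  obtain ⟨Ψ, hΨ, hemb, hdisj, hcpt⟩ := exists_almost_disjoint_copies (E := FiniteSets)
    (fun i (p : Bool → Instructions) => Nat.pair (p false i) (p true i))
    (fun i => (continuous_of_discreteTopology
      (f := fun a : Fin (i + 2) × Fin (i + 2) => Nat.pair a.1 a.2)).comp
        (by fun_prop : Continuous fun p : Bool → Instructions => (p false i, p true i)))
    (fun p q h => by
      funext b i
      have := Nat.pair_eq_pair.1 (h i)
      cases b with
      | false => exact Fin.ext this.1
      | true => exact Fin.ext this.2)
  have hν := continuous_rationalLaw hΨ
  refine ⟨range (rationalLaw Ψ hΨ), isCompact_range hν, range_nonempty _, ?_, ?_, ?_⟩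
  · rintro _ ⟨p, rfl⟩
    exact locallyCompactSpace_ratSupport_rationalLaw hΨ hemb p
  · rintro _ ⟨p, rfl⟩ _ ⟨q, rfl⟩ hne
    refine (hdisj p q fun h => hne (h ▸ rfl)).subset (inter_subset_inter ?_ ?_)
    · exact (ratSupport_rationalLaw_subset hΨ hemb p).trans (image_subset_range _ _)
    · exact (ratSupport_rationalLaw_subset hΨ hemb q).trans (image_subset_range _ _)
  rintro V hV ⟨_, ⟨p, rfl⟩, hpV⟩
  obtain ⟨T, hT⟩ := exists_cylinderOf_subset ((hV.preimage hν).mem_nhds hpV)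
  let pair : Instructions → Instructions → Bool → Instructions := fun x y b => cond b y x
  have hpair : Continuous fun a : Instructions × Instructions => pair a.1 a.2 :=
    continuous_pi fun b => by
      cases b with
      | false => exact continuous_fst
      | true => exact continuous_snd
  have hcyl : ∀ x n, IsCompact (cylinderOf x n) := fun x n => (isClopen_cylinderOf x n).1.isCompact
  refine ⟨rationalLaw Ψ hΨ '' {q | ∀ b, q b ∈ cylinderOf (p b) T}, ?_, ?_, ?_⟩
  · rintro _ ⟨q, hq, rfl⟩
    exact ⟨mem_range_self q, hT q hq⟩
  · have : IsClosed {q : Bool → Instructions | ∀ b, q b ∈ cylinderOf (p b) T} := by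
      rw [ofPred_forall]
      exact isClosed_iInter fun b => (isClopen_cylinderOf _ _).1.preimage (continuous_apply b)
    exact this.isCompact.image hν
  rintro A - ⟨S, hS, hAS⟩
  -- Otherwise the projections `Z n` of the closed sets given by `closure (S n)` cover the cylinder.
  -- By Baire one of them contains a smaller cylinder, and escape in the first sequence contradicts
  -- tightness of `closure (S n)`.
  obtain ⟨x, hx, hxA⟩ : ∃ x ∈ cylinderOf (p false) T, ∀ y ∈ cylinderOf (p true) T,
      rationalLaw Ψ hΨ (pair x y) ∉ A := by
    by_contra! hcon
    let Z : ℕ → Set Instructions := fun n => Prod.fst '' (univ ×ˢ cylinderOf (p true) T ∩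
      {a | rationalLaw Ψ hΨ (pair a.1 a.2) ∈ closure (S n)})
    have hZ : ∀ n, IsClosed (Z n) := fun n =>
      (((isCompact_univ.prod (hcyl _ _)).inter_right
        (isClosed_closure.preimage (hν.comp hpair))).image continuous_fst).isClosed
    have hcov : (⋃ n : Option ℕ, n.elim (cylinderOf (p false) T)ᶜ Z) = univ := by
      refine eq_univ_of_forall fun x => ?_
      by_cases hx : x ∈ cylinderOf (p false) T
      · obtain ⟨y, hy, hyA⟩ := hcon x hx
        obtain ⟨n, hn⟩ := mem_iUnion.1 (hAS hyA)
        exact mem_iUnion.2 ⟨some n, (x, y), ⟨⟨mem_univ _, hy⟩, subset_closure hn⟩, rfl⟩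
      · exact mem_iUnion.2 ⟨none, hx⟩
    have hden := dense_iUnion_interior_of_closed (fun n => by
      cases n with
      | none => exact (isClopen_cylinderOf _ _).2.isClosed_compl
      | some n => exact hZ n) hcov
    obtain ⟨x, hx, hxn⟩ := hden.inter_open_nonempty _ (isClopen_cylinderOf (p false) T).2
      ⟨p false, fun _ _ => rfl⟩
    obtain ⟨n, hn⟩ := mem_iUnion.1 hxn
    cases n with
    | none => exact interior_subset hn hx
    | some n =>
      have hnhds : (fun q : Bool → Instructions => q false) ⁻¹' Z n ∈ 𝓝 fun _ => x :=
        (continuous_apply false).continuousAt.preimage_mem_nhds (mem_interior_iff_mem_nhds.1 hn)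
      obtain ⟨T', hT'⟩ := exists_cylinderOf_subset hnhds
      refine not_uniformlyTight_image_rationalLaw hΨ hcpt false x T'
        (Q := {q | rationalLaw Ψ hΨ q ∈ closure (S n)}) ?_
        ((hS n).closure.mono (image_subset_iff.2 fun q hq => hq))
      intro x' hx'
      obtain ⟨⟨a, y⟩, ⟨-, hy⟩, rfl⟩ := hT' (fun _ => x') fun _ => hx'
      exact ⟨pair a y, hy, rfl⟩
  -- The section over `x` avoids `A` entirely; escape in the second sequence shows that it is not
  -- tight.
  refine ⟨rationalLaw Ψ hΨ '' (pair x '' cylinderOf (p true) T), ?_, ?_, ?_⟩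
  · rintro _ ⟨_, ⟨y, hy, rfl⟩, rfl⟩
    refine ⟨⟨_, fun b => ?_, rfl⟩, hxA y hy⟩
    cases b with
    | false => exact hx
    | true => exact hy
  · exact ((hcyl _ _).image (hpair.comp (Continuous.prodMk_right x))).image hν
  · exact not_uniformlyTight_image_rationalLaw hΨ hcpt true (p true) T
      fun y hy => ⟨pair x y, ⟨y, hy, rfl⟩, rfl⟩

end Construction

theorem mainTheorem7 :
    (∃ K : Set (ProbabilityMeasure ℚ), IsRefinedPreissCompactum K) ∧
    ∀ K : Set (ProbabilityMeasure ℚ), IsRefinedPreissCompactum K →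
      ∀ f : K → Set.Icc (0 : ℝ) 1, @Measurable K (Set.Icc (0 : ℝ) 1) (borel K) (borel _) f →
        ∃ B : Set K, MeasurableSet[borel K] B ∧
          ¬ SigmaUniformlyTight (Subtype.val '' B) ∧
          ((∃ c, ∀ x ∈ B, f x = c) ∨ Set.InjOn f B) :=
  ⟨exists_isRefinedPreissCompactum, fun _ hK f hf => hK.exists_const_or_injOn f hf⟩
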